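/- Let $G=(V,E)$ be a connected undirected simple graph with $n=|V|\ge 2$ vertices, $m=|E|$ edges and non-negative weights $w:E\to\mathbb{Q}$, given by adjacency lists; let $s,t\in V$ and $\alpha\in\mathbb{Q}$. For $X\subseteq V$ let $\mathcal{P}_\beta(u,t,G-X)$ be the set of simple $ut$-paths $\pi$ of $G-X$ with $w(\pi)=\sum_{e\in\pi}w(e)\le\beta$ (the $\beta$-bounded paths), and let $\gamma=|\mathcal{P}_\alpha(s,t,G)|$. Fix a routine that computes a shortest path tree (distances and parents) from a given source in any non-negatively weighted undirected graph; on a graph with $n'$ vertices and $m'$ edges it takes at most $t(n',m')$ steps, where $t$ is non-decreasing in both arguments, and at most $K(n'+m')$ memory cells. Consider the recursive procedure $\mathrm{ListPaths}(u,t,\beta,\pi_{su},G')$, where $G'$ is $G$ without the vertices of $\pi_{su}$ other than $u$: 1. Compute the longest common prefix $\pi_{uu'}$ of $\mathcal{P}_\beta(u,t,G')$ as follows. Compute shortest path trees $T_u$ from $u$ and $T_t$ from $t$ in $G'$ with the distances $d_{G'}(u,\cdot)$ and $d_{G'}(t,\cdot)$; let $u=v_0,v_1,\dots,v_k=t$ be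 the tree path in $T_u$. For $i=0,\dots,k-1$, stop with $u'=v_i$ if there is an edge $(x,z)\ne(v_i,v_{i+1})$ of $G'$ such that $z$ lies in the subtree of $T_u$ rooted at $v_{i+1}$, $x$ is $v_i$ or lies in the subtree of $T_u$ rooted at another child of $v_i$, and $d_{G'}(u,x)+w(x,z)+d_{G'}(z,t)\le\beta$. If there is no stop, $u'=t$. The prefix is $\pi_{uu'}=v_0\cdots u'$. 2. If $u'=t$, output $\pi_{su}\pi_{uu'}$ and return. 3. Otherwise compute a shortest path tree from $t$ in $G'-\pi_{uu'}$, with distances $d$, and for each neighbour $v$ of $u'$ in $G'$ that is not on $\pi_{uu'}$ and satisfies $d(v,t)+w(u',v)\le\beta-w(\pi_{uu'})$, call $\mathrm{ListPaths}(v,t,\beta-w(\pi_{uu'})-w(u',v),\pi_{su}\cdot\pi_{uu'}\cdot(u',v),G'-\pi_{uu'})$. The algorithm computes the distances from $t$ in $G$ and, if $d_G(s,t)\le\alpha$, calls $\mathrm{ListPaths}(s,t,\alpha,\emptyset,G)$. On a unit-cost random access machine with rational numbers as words, it has an implementation such that, for a universal constant $C$: * it outputs every path of $\mathcal{P}_\alpha(s,t,G)$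 exactly once and outputs nothing else; * it makes at most $C\,(m+t(n,m))\max\{1,\gamma\}$ steps in total (so $O((m+t(n,m))\gamma)$ if $\gamma\ge1$); * it uses at most $C(K+1)\,m$ memory cells, including the input (so $O(m)$ space); * if $\gamma\ge1$, then in every call of $\mathrm{ListPaths}$ the set $\mathcal{P}_\beta(u,t,G')$ is non-empty and the computed $\pi_{uu'}$ is its longest common prefix, and the call either has $u'=t$ and makes no recursive calls, or makes at least two recursive calls. -/

import Mathlib

/-! ### Paths, lengths, distances -/

section Graphs

variable {V : Type}

/-- The length of a walk: the sum of the weights of its edges. -/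
def walkLength {G : SimpleGraph V} (w : Sym2 V → ℚ) {u v : V} (p : G.Walk u v) : ℚ :=
  (p.edges.map w).sum

/-- The set of `α`-bounded simple paths from `u` to `t` in `G - X`, where `X` is the set of the
vertices in the list `X`. A path is written as the list of its vertices, from `u` to `t`. -/
def boundedPaths (G : SimpleGraph V) (w : Sym2 V → ℚ) (X : List V) (u t : V) (α : ℚ) :
    Set (List V) :=
  {l | ∃ p : G.Walk u t, p.IsPath ∧ walkLength w p ≤ α ∧ (∀ x ∈ p.support, x ∉ X) ∧ p.support = l}

/-- `π` is the longest common prefix of the lists in `S`. -/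
def IsLongestCommonPrefix (π : List V) (S : Set (List V)) : Prop :=
  (∀ l ∈ S, π <+: l) ∧ ∀ ρ : List V, (∀ l ∈ S, ρ <+: l) → ρ.length ≤ π.length

/-- `d` is the distance from `s` to `v` (`⊤` if there is no walk). -/
def IsDist (G : SimpleGraph V) (w : Sym2 V → ℚ) (s v : V) (d : WithTop ℚ) : Prop :=
  (∀ p : G.Walk s v, d ≤ (walkLength w p : WithTop ℚ)) ∧
    (d = ⊤ ∨ ∃ p : G.Walk s v, (walkLength w p : WithTop ℚ) = d)

/-- Adjacency lists: the vertices and, for each of them, the neighbours with the edge weights.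
Vertices are names from `V`, so that an array indexed by vertices is a function on `V`. -/
structure AdjGraph (V : Type) where
  verts : List V
  nbrs : V → List (V × ℚ)

/-- The number of memory cells that the adjacency lists occupy: one cell of an array and a list
cell for each vertex, and a list cell for each entry of a list (a list cell takes four words). -/
def AdjGraph.size (A : AdjGraph V) : ℕ :=
  (A.verts.map fun v => 5 + 4 * (A.nbrs v).length).sum

/-- `A` represents the undirected graph with vertex set `A.verts`, the edges of `G` and the
weights `w` (names of `V` that are not in `A.verts` are isolated in `G`). -/
structure AdjGraph.Represents (A : AdjGraph V) (G : SimpleGraph V) (w : Sym2 V → ℚ) : Prop where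
  verts_nodup : A.verts.Nodup
  mem_verts : ∀ u v, G.Adj u v → u ∈ A.verts
  nbrs_nodup : ∀ u ∈ A.verts, (A.nbrs u).Nodup
  mem_nbrs : ∀ u ∈ A.verts, ∀ v q, (v, q) ∈ A.nbrs u ↔ G.Adj u v ∧ q = w s(u, v)

/-- The result of a single source shortest path computation: distances and tree parents. -/
structure SPTree (V : Type) where
  dist : V → WithTop ℚ
  parent : V → Option V

/-- `T` is a shortest path tree from `s` in the graph with vertices `verts`, edges of `G`, weights
`w`: the distances are right, the parents are on shortest paths, and parent pointers do not form
cycles. Nothing is said about names outside `verts`. -/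
structure SPTree.IsTree (T : SPTree V) (verts : List V) (G : SimpleGraph V) (w : Sym2 V → ℚ)
    (s : V) : Prop where
  dist_spec : ∀ v ∈ verts, IsDist G w s v (T.dist v)
  root : T.parent s = none
  unreached : ∀ v ∈ verts, T.dist v = ⊤ → T.parent v = none
  reached : ∀ v ∈ verts, v ≠ s → T.dist v ≠ ⊤ →
    ∃ p, T.parent v = some p ∧ G.Adj p v ∧ T.dist v = T.dist p + (w s(p, v) : WithTop ℚ)
  acyclic : ∃ depth : V → ℕ, ∀ v ∈ verts, ∀ p, T.parent v = some p → depth p < depth v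

/-- A routine for single source shortest paths, with the number of steps and of memory cells
(including its result) that it uses on each input. -/
structure SSSPRoutine (V : Type) where
  tree : AdjGraph V → V → SPTree V
  time : AdjGraph V → V → ℕ
  space : AdjGraph V → V → ℕ

/-- `R` computes shortest path trees of all undirected non-negatively weighted graphs, connected
or not, whose vertices are names from `V`; on a graph with `n` vertices and `m` edges it makes at
most `tt n m` steps and uses at most `K * (n + m)` cells. -/
structure SSSPRoutine.Solves (R : SSSPRoutine V) (tt : ℕ → ℕ → ℕ) (K : ℕ) : Prop where
  correct : ∀ (A : AdjGraph V) (G : SimpleGraph V) (w : Sym2 V → ℚ), A.Represents G w →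
    (∀ e ∈ G.edgeSet, 0 ≤ w e) → ∀ s ∈ A.verts, (R.tree A s).IsTree A.verts G w s
  time_le : ∀ (A : AdjGraph V) (G : SimpleGraph V) (w : Sym2 V → ℚ), A.Represents G w →
    (∀ e ∈ G.edgeSet, 0 ≤ w e) → ∀ s ∈ A.verts,
      R.time A s ≤ tt A.verts.length G.edgeSet.ncard
  space_le : ∀ (A : AdjGraph V) (G : SimpleGraph V) (w : Sym2 V → ℚ), A.Represents G w →
    (∀ e ∈ G.edgeSet, 0 ≤ w e) → ∀ s ∈ A.verts,
      R.space A s ≤ K * (A.verts.length + G.edgeSet.ncard)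

end Graphs

/-! ### The cost model

A unit-cost random access machine: a cell holds a vertex name, a pointer, a rational number or a
flag; an elementary step reads or writes boundedly many cells or does boundedly many arithmetic
operations and comparisons. -/

/-- A completed computation: its value, the items it has output (in order), its number of steps,
the number of cells it has allocated and not released at its end, and the peak number of cells that
it has in use at a time (beyond the cells in use when it starts). -/
structure Run (O α : Type) where
  val : α
  out : List O
  time : ℕ
  net : ℕ
  peak : ℕ

namespace Run

variable {O α β : Type}

/-- Sequential composition. -/
def bind (x : Run O α) (f : α → Run O β) : Run O β :=
  let y := f x.val
  ⟨y.val, x.out ++ y.out, x.time + y.time, x.net + y.net, max x.peak (x.net + y.peak)⟩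

instance : Monad (Run O) where
  pure a := ⟨a, [], 0, 0, 0⟩
  bind := bind

/-- One elementary step with result `a`. -/
def op (a : α) : Run O α := ⟨a, [], 1, 0, 0⟩

/-- A new list cell (a link and at most three words), put in front of the list `l`. -/
def cons (a : α) (l : List α) : Run O (List α) := ⟨a :: l, [], 1, 4, 4⟩

/-- A new array of `n` cells with initial entries `b`. -/
def newArray (n : ℕ) (b : β) : Run O (α → β) := ⟨fun _ => b, [], n + 1, n, n⟩

/-- Write the list `l` to the output. -/
def emit (l : List α) : Run (List α) Unit := ⟨(), [l], l.length + 1, 0, 0⟩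

/-- Execution of `x` as a procedure call. It needs a frame of at most 16 cells for the return
address and the scalar local variables. On return the memory allocated during the call is released;
only a copy of the returned value, of `size` many cells, stays allocated for the caller. -/
def proc (size : α → ℕ) (x : Run O α) : Run O α :=
  ⟨x.val, x.out, x.time + size x.val + 1, size x.val, 16 + x.peak + size x.val⟩

/-- `for a in l do b := f b a`. -/
def loop (f : β → α → Run O β) : β → List α → Run O β
  | b, [] => op b
  | b, a :: l => do
    let a ← op a
    let b ← f b a
    loop f b l

/-- Search of a list for an element that passes a test, with a break at the first success. -/
def search (f : α → Run O Bool) : List α → Run O Bool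
  | [] => op false
  | a :: l => do
    let a ← op a
    if ← f a then pure true else search f l

/-- Push the elements of `l` one after the other on the list `acc`. -/
def pushAll (l acc : List α) : Run O (List α) :=
  loop (fun acc a => cons a acc) acc l

/-- A new list with the elements of `l` that pass a test (in reverse order). -/
def select (f : α → Run O Bool) (l : List α) : Run O (List α) :=
  loop (fun acc a => do if ← f a then cons a acc else pure acc) [] l

end Run

/-! ### The algorithm -/

section Algorithm

open Run

variable {V : Type} [DecidableEq V]

/-- Computing a shortest path tree from `s` in `A`. The memory of the routine is held until the
calling procedure returns. -/
def SSSPRoutine.run (R : SSSPRoutine V) (A : AdjGraph V) (s : V) : Run (List V) (SPTree V) :=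
  ⟨R.tree A s, [], R.time A s, R.space A s, R.space A s⟩

/-- Set the flags of the vertices of `X` in an array. -/
def setFlags (X : List V) (flag : V → Bool) : Run (List V) (V → Bool) :=
  loop (fun flag x => op (Function.update flag x true)) flag X

/-- Adjacency lists of the graph without the flagged vertices. -/
def removeFlagged (A : AdjGraph V) (flag : V → Bool) : Run (List V) (AdjGraph V) := do
  let verts ← select (fun v => op (!flag v)) A.verts
  let nbrs ← newArray A.verts.length []
  let nbrs ← loop (fun (nbrs : V → List (V × ℚ)) v => do
      let l ← select (fun e => op (!flag e.1)) (A.nbrs v)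
      op (Function.update nbrs v l)) nbrs verts
  pure ⟨verts, nbrs⟩

/-- The vertices from the root of a tree to `v`, followed by `acc`, along the parent pointers.
`k` bounds the number of rounds; the calls below pass the number of vertices. -/
def treePath (parent : V → Option V) : (k : ℕ) → (v : V) → (acc : List V) →
    Run (List V) (List V)
  | 0, _, acc => pure acc
  | k + 1, v, acc => do
    let acc ← cons v acc
    match ← op (parent v) with
    | none => pure acc
    | some p => treePath parent k p acc

/-- The lists of the children of all vertices in a tree that is given by parent pointers. Here and
below `n` is the size of an array with one entry for each vertex of the input graph. -/
def childLists (n : ℕ) (parent : V → Option V) (verts : List V) :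
    Run (List V) (V → List V) := do
  let kids ← newArray n []
  loop (fun (kids : V → List V) v => do
    match ← op (parent v) with
    | none => pure kids
    | some p =>
      let l ← cons v (kids p)
      op (Function.update kids p l)) kids verts

/-- Traversal of the subtrees rooted at the vertices on the stack; the vertices are put in front of
`acc`. `k` bounds the number of rounds; the call below passes the number of vertices. -/
def subtrees (kids : V → List V) : (k : ℕ) → (stack acc : List V) → Run (List V) (List V)
  | _, [], acc => op acc
  | 0, _ :: _, acc => pure acc
  | k + 1, x :: stack, acc => do
    let acc ← cons x acc
    let stack ← pushAll (kids x) stack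
    subtrees kids k stack acc

/-- The main loop of the longest prefix computation. The first list is what remains of the path
from the root `u` to `t` in a shortest path tree from `u`, and `acc` is the reversed part that has
been traversed. In the round of the tree edge `(v, next)`, `block` consists of `v` and the subtrees
of the children of `v` other than `next`. All blocks up to this one are flagged then, so the
subtree of `next` consists of the vertices reachable from `u` that are not flagged. If some edge
`(x, z)` other than `(v, next)` from the block into this subtree has `ds x + w(x,z) + dt z ≤ α`, the
loop stops, and the part of the path up to `v` is the result. -/
def lcpLoop (H : AdjGraph V) (ds dt : V → WithTop ℚ) (kids : V → List V) (α : ℚ) :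
    List V → (flag : V → Bool) → (acc : List V) → Run (List V) (List V)
  | v :: next :: rest, flag, acc => do
    let acc ← cons v acc
    let siblings ← select (fun y => op (decide (y ≠ next))) (kids v)
    let start ← cons v []
    let block ← subtrees kids H.verts.length siblings start
    let flag ← setFlags block flag
    let found ← search (fun x => search (fun (e : V × ℚ) =>
        op (!flag e.1 && !(decide (x = v) && decide (e.1 = next)) &&
          decide (ds x + (e.2 : WithTop ℚ) + dt e.1 ≤ (α : WithTop ℚ)))) (H.nbrs x)) block
    if found then pure acc else lcpLoop H ds dt kids α (next :: rest) flag acc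
  | [v], _, acc => cons v acc
  | [], _, acc => pure acc

/-- The longest common prefix of the `α`-bounded paths from `u` to `t` in `H`, as the reversed list
of its vertices, together with its length. The prefix is a path in the shortest path tree, so the
length is the distance of its end from `u`. -/
def lcp (R : SSSPRoutine V) (n : ℕ) (H : AdjGraph V) (u t : V) (α : ℚ) :
    Run (List V) (List V × ℚ) := do
  let Ts ← R.run H u
  let Tt ← R.run H t
  let path ← treePath Ts.parent H.verts.length t []
  let kids ← childLists n Ts.parent H.verts
  let flag ← newArray n false
  let rev ← lcpLoop H Ts.dist Tt.dist kids α path flag []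
  let len ← op ((Ts.dist (rev.headD u)).untopD 0)
  pure (rev, len)

/-- The arguments of a recursive call that vary: the current vertex `u`, the remaining bound `α`,
and the vertices of the prefix from `s` to `u`, without `u` and in reverse order (a linked list that
shares its tail with the prefix of the parent call). The graph argument of the call is the input
graph without the vertices of `pre`; it is not stored, but rebuilt from `pre`. -/
structure Call (V : Type) where
  u : V
  α : ℚ
  pre : List V

/-- First part of a call: rebuild its graph and compute the longest common prefix, as a list of
vertices in order, with its last vertex and its length. -/
def findPrefix (R : SSSPRoutine V) (A : AdjGraph V) (t : V) (c : Call V) :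
    Run (List V) (List V × V × ℚ) :=
  proc (fun r => 4 * r.1.length + 2) do
    let flag ← newArray A.verts.length false
    let flag ← setFlags c.pre flag
    let H ← removeFlagged A flag
    let r ← lcp R A.verts.length H c.u t c.α
    let π ← pushAll r.1 []
    pure (π, r.1.headD c.u, r.2)

/-- The recursive calls to be made at the end `u` of the extended prefix `pre`: one for each
neighbour `v` of `u` that is not in `pre` and from which, without the vertices of `pre`, `t` can
be reached within the bound. All tests are made before the first recursive call, so that the
distances need not be kept during the recursion. -/
def findChildren (R : SSSPRoutine V) (A : AdjGraph V) (t u : V) (α : ℚ) (pre : List V) :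
    Run (List V) (List (Call V)) :=
  proc (fun cs => 4 * cs.length) do
    let flag ← newArray A.verts.length false
    let flag ← setFlags pre flag
    let H ← removeFlagged A flag
    let T ← R.run H t
    loop (fun cs (e : V × ℚ) => do
      let b ← op (!flag e.1 && decide (T.dist e.1 + (e.2 : WithTop ℚ) ≤ (α : WithTop ℚ)))
      if b then cons (⟨e.1, α - e.2, pre⟩ : Call V) cs else pure cs) [] (A.nbrs u)

/-- A call without the execution of its recursive calls. The value consists of the longest common
prefix (with which the prefix is extended first) and of the list of the recursive calls to be made.
If the extended prefix ends in `t`, it is output and there are no recursive calls. -/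
def callBody (R : SSSPRoutine V) (A : AdjGraph V) (t : V) (c : Call V) :
    Run (List V) (List V × List (Call V)) := do
  let r ← findPrefix R A t c
  let pre ← pushAll r.1 c.pre
  let last ← op r.2.1
  if last = t then
    proc (fun _ => 0) do
      let π ← pushAll pre []
      emit π
    pure (r.1, [])
  else
    let cs ← findChildren R A t last (c.α - r.2.2) pre
    pure (r.1, cs)

/-- The recursive procedure. The first argument bounds the depth of the recursion. -/
def listPaths (R : SSSPRoutine V) (A : AdjGraph V) (t : V) : ℕ → Call V → Run (List V) Unit
  | 0, _ => pure ()
  | k + 1, c => proc (fun _ => 0) do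
    let r ← callBody R A t c
    loop (fun _ d => listPaths R A t k d) () r.2

/-- The whole algorithm: if there is an `α`-bounded path from `s` to `t` at all (the test that is
made before each recursive call), start the recursion with the empty prefix. -/
def listAllPaths (R : SSSPRoutine V) (A : AdjGraph V) (s t : V) (α : ℚ) :
    Run (List V) Unit := do
  let b ← proc (fun _ => 1) do
    let T ← R.run A t
    op (decide (T.dist s ≤ (α : WithTop ℚ)))
  if b then listPaths R A t A.verts.length ⟨s, α, []⟩ else pure ()

/-- `d` is a child of `c` in the recursion tree. -/
def IsChildCall (R : SSSPRoutine V) (A : AdjGraph V) (t : V) (c d : Call V) : Prop :=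
  d ∈ (callBody R A t c).val.2

end Algorithm

/-!
The algorithm is correct because one call computes the longest common prefix of its bounded paths
and then distributes these paths, by the vertex that follows the prefix, to its recursive calls.

*The prefix.* Let `v, next` be consecutive vertices on the path from `u` to `t` in a shortest path
tree from `u`, and suppose that all bounded paths start with the tree path to `v`. The last edge by
which a path to `t` enters the subtree of `next` is enough to decide whether all of them continue
with `next`. If some bounded path does not, then its last entry is an edge `(x, z)` other than
`(v, next)` that passes the test of `lcpLoop`; since no edge passed the test in earlier rounds, `x`
lies in the current block (`IsSPForest.prefix_append_next`). Conversely, an edge that passes the test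
gives a bounded walk that enters the subtree of `next` once and not by `(v, next)`, made up of a part
outside the subtree and a part inside; shortcutting both parts gives a simple bounded path that does
not continue with `next` (`IsSPForest.exists_single_entry`,
`IsSPForest.exists_boundedPath_not_prefix`). Weights may be zero, so a shortest path from `z` to `t`
may itself pass through `(v, next)`; then its part up to `next` is exchanged for the tree path, and
this is where it matters that the graph is undirected. The blocks of the rounds are disjoint, so the
whole loop is linear in the size of the graph (`lcpLoop_spec`, `lcpLoop_within`).

*The recursion.* The distance test holds for exactly those neighbours of the end of the prefix from
which a bounded path leads to `t` (`SPTree.IsTree.dist_le_iff`), so every call has a bounded path. If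
the prefix does not end in `t`, there are at least two recursive calls, as the only one would extend
the common prefix (`ValidInput.callBody_spec`). Hence each leaf of the recursion tree outputs one
path, each inner node has at least two children, and the tree has at most `2γ - 1` nodes, which gives
the time bound. As for memory, a call holds during its recursion only `O(|π| + deg u')` cells, where
`π` is its prefix and `u'` the end of `π`; along a branch of the tree the prefixes are disjoint, so
these cells sum up to `O(n + m)` (`heldBound`, `ValidInput.listPaths_spec`).
-/

/-! ### Values and costs of the program constructs -/

namespace Run

variable {O α β : Type}

@[simp] lemma bind_val (x : Run O α) (f : α → Run O β) : (x >>= f).val = (f x.val).val := rfl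
@[simp] lemma bind_out (x : Run O α) (f : α → Run O β) :
    (x >>= f).out = x.out ++ (f x.val).out := rfl
@[simp] lemma bind_time (x : Run O α) (f : α → Run O β) :
    (x >>= f).time = x.time + (f x.val).time := rfl
@[simp] lemma bind_net (x : Run O α) (f : α → Run O β) :
    (x >>= f).net = x.net + (f x.val).net := rfl
@[simp] lemma bind_peak (x : Run O α) (f : α → Run O β) :
    (x >>= f).peak = max x.peak (x.net + (f x.val).peak) := rfl
@[simp] lemma pure_val (a : α) : (pure a : Run O α).val = a := rfl
@[simp] lemma pure_out (a : α) : (pure a : Run O α).out = [] := rfl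
@[simp] lemma pure_time (a : α) : (pure a : Run O α).time = 0 := rfl
@[simp] lemma pure_net (a : α) : (pure a : Run O α).net = 0 := rfl
@[simp] lemma pure_peak (a : α) : (pure a : Run O α).peak = 0 := rfl
@[simp] lemma op_val (a : α) : (op a : Run O α).val = a := rfl
@[simp] lemma op_out (a : α) : (op a : Run O α).out = [] := rfl
@[simp] lemma op_time (a : α) : (op a : Run O α).time = 1 := rfl
@[simp] lemma op_net (a : α) : (op a : Run O α).net = 0 := rfl
@[simp] lemma op_peak (a : α) : (op a : Run O α).peak = 0 := rfl
@[simp] lemma cons_val (a : α) (l : List α) : (cons a l : Run O (List α)).val = a :: l := rfl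
@[simp] lemma proc_out (size : α → ℕ) (x : Run O α) : (proc size x).out = x.out := rfl
@[simp] lemma proc_time (size : α → ℕ) (x : Run O α) :
    (proc size x).time = x.time + size x.val + 1 := rfl
@[simp] lemma proc_net (size : α → ℕ) (x : Run O α) : (proc size x).net = size x.val := rfl
@[simp] lemma proc_peak (size : α → ℕ) (x : Run O α) :
    (proc size x).peak = 16 + x.peak + size x.val := rfl

lemma loop_cons (f : β → α → Run O β) (b : β) (a : α) (l : List α) :
    loop f b (a :: l) = (op a >>= fun a => f b a >>= fun b => loop f b l) := rfl

@[simp] lemma loop_val (f : β → α → Run O β) (b : β) (l : List α) :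
    (loop f b l).val = l.foldl (fun b a => (f b a).val) b := by
  induction l generalizing b with
  | nil => rfl
  | cons a l ih => simp [loop_cons, ih]

@[simp] lemma search_val (f : α → Run O Bool) (l : List α) :
    (search f l).val = l.any fun a => (f a).val := by
  induction l with
  | nil => rfl
  | cons a l ih =>
    simp only [search, bind_val, op_val, List.any_cons]
    cases h : (f a).val <;> simp [ih]

@[simp] lemma pushAll_val (l acc : List α) :
    (pushAll l acc : Run O (List α)).val = l.reverse ++ acc := by
  simp [pushAll]

@[simp] lemma select_val (f : α → Run O Bool) (l : List α) :
    (select f l).val = (l.filter fun a => (f a).val).reverse := by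
  have key : ∀ acc : List α, l.foldl (fun acc a =>
      (do if ← f a then cons a acc else pure acc : Run O (List α)).val) acc =
      (l.filter fun a => (f a).val).reverse ++ acc := by
    induction l with
    | nil => simp
    | cons a l ih =>
      intro acc
      rw [List.foldl_cons, ih]
      cases h : (f a).val <;> simp [h]
  rw [select, loop_val, key, List.append_nil]

/-- `x` outputs nothing, makes at most `τ` steps and never has more than `σ` cells in use. -/
structure Within (x : Run O α) (τ σ : ℕ) : Prop where
  out : x.out = []
  time : x.time ≤ τ
  net : x.net ≤ σ
  peak : x.peak ≤ σ

namespace Within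

lemma mono {x : Run O α} {τ σ τ' σ' : ℕ} (h : Within x τ σ) (hτ : τ ≤ τ') (hσ : σ ≤ σ') :
    Within x τ' σ' :=
  ⟨h.out, h.time.trans hτ, h.net.trans hσ, h.peak.trans hσ⟩

lemma bind {x : Run O α} {f : α → Run O β} {τ σ τ' σ' : ℕ} (hx : Within x τ σ)
    (hf : Within (f x.val) τ' σ') : Within (x >>= f) (τ + τ') (σ + σ') := by
  obtain ⟨h1, h2, h3, h4⟩ := hx
  obtain ⟨k1, k2, k3, k4⟩ := hf
  refine ⟨by simp [h1, k1], ?_, ?_, ?_⟩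
  · simpa using add_le_add h2 k2
  · simpa using add_le_add h3 k3
  · rw [bind_peak]
    exact max_le (by omega) (by omega)

lemma bind_of_val_eq {x : Run O α} {f : α → Run O β} {a : α} {τ σ τ' σ' : ℕ}
    (hx : Within x τ σ) (ha : x.val = a) (hf : Within (f a) τ' σ') :
    Within (x >>= f) (τ + τ') (σ + σ') :=
  hx.bind (ha ▸ hf)

lemma ite_neg {p : Prop} [Decidable p] (hp : ¬ p) {x y : Run O α} {τ σ : ℕ}
    (h : Within y τ σ) : Within (if p then x else y) τ σ := by
  rwa [if_neg hp]

protected lemma pure (a : α) : Within (pure a : Run O α) 0 0 := by constructor <;> simp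

lemma op (a : α) : Within (Run.op a : Run O α) 1 0 := by constructor <;> simp

lemma cons (a : α) (l : List α) : Within (Run.cons a l : Run O (List α)) 1 4 := by
  constructor <;> simp [Run.cons]

lemma newArray (n : ℕ) (b : β) : Within (Run.newArray n b : Run O (α → β)) (n + 1) n := by
  constructor <;> simp [Run.newArray]

lemma loop {f : β → α → Run O β} {l : List α} {τ σ : α → ℕ}
    (h : ∀ b, ∀ a ∈ l, Within (f b a) (τ a) (σ a)) (b : β) :
    Within (loop f b l) ((l.map fun a => τ a + 1).sum + 1) (l.map σ).sum := by
  induction l generalizing b with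
  | nil => exact op b
  | cons a l ih =>
    rw [loop_cons]
    refine ((op a).bind ((h b a (by simp)).bind
      (ih (fun b a ha => h b a (by simp [ha])) _))).mono ?_ ?_
    · simp; omega
    · simp

lemma loop_const {f : β → α → Run O β} {l : List α} {τ σ : ℕ}
    (h : ∀ b, ∀ a ∈ l, Within (f b a) τ σ) (b : β) :
    Within (Run.loop f b l) (l.length * (τ + 1) + 1) (l.length * σ) := by
  simpa using loop (τ := fun _ => τ) (σ := fun _ => σ) h b

lemma search {f : α → Run O Bool} {l : List α} {τ σ : α → ℕ}
    (h : ∀ a ∈ l, Within (f a) (τ a) (σ a)) :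
    Within (search f l) ((l.map fun a => τ a + 1).sum + 1) (l.map σ).sum := by
  induction l with
  | nil => exact op false
  | cons a l ih =>
    have h1 : Within (if (f a).val = true then Pure.pure true else Run.search f l)
        ((l.map fun a => τ a + 1).sum + 1) (l.map σ).sum := by
      split
      · exact (Within.pure true).mono (by omega) (by omega)
      · exact ih fun a ha => h a (by simp [ha])
    refine ((op a).bind ((h a (by simp)).bind h1)).mono ?_ ?_
    · simp; omega
    · simp

lemma pushAll (l acc : List α) :
    Within (pushAll l acc : Run O (List α)) (2 * l.length + 1) (4 * l.length) :=
  (loop_const (τ := 1) (σ := 4) (fun b a _ => cons a b) acc).mono (by omega) (by omega)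

lemma select_op (p : α → Bool) (l : List α) :
    Within (select (fun a => Run.op (p a)) l : Run O (List α))
      (3 * l.length + 1) (4 * l.length) := by
  refine (loop_const (τ := 2) (σ := 4) (fun b a _ => ?_) []).mono (by omega) (by omega)
  refine ((op (p a)).bind (τ' := 1) (σ' := 4) ?_).mono le_rfl le_rfl
  split
  · exact cons a b
  · exact (Within.pure b).mono (by omega) (by omega)

/-- The frame of a procedure call and the copy of its value come on top of the cost of the body. -/
lemma proc {x : Run O α} {τ σ : ℕ} (h : Within x τ σ) (size : α → ℕ) :
    Within (proc size x) (τ + size x.val + 1) (16 + σ + size x.val) := by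
  obtain ⟨h1, h2, h3, h4⟩ := h
  refine ⟨by simpa using h1, ?_, ?_, ?_⟩ <;> simp <;> omega

end Within

end Run

/-! ### Lengths of walks and bounded paths -/

section Walks

variable {V : Type} {G : SimpleGraph V} {w : Sym2 V → ℚ}

open SimpleGraph

@[simp] lemma walkLength_nil (u : V) : walkLength w (Walk.nil : G.Walk u u) = 0 := by
  simp [walkLength]

@[simp] lemma walkLength_cons {u v t : V} (h : G.Adj u v) (p : G.Walk v t) :
    walkLength w (Walk.cons h p) = w s(u, v) + walkLength w p := by
  simp [walkLength]

@[simp] lemma walkLength_append {u v t : V} (p : G.Walk u v) (q : G.Walk v t) :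
    walkLength w (p.append q) = walkLength w p + walkLength w q := by
  simp [walkLength, Walk.edges_append]

@[simp] lemma walkLength_reverse {u v : V} (p : G.Walk u v) :
    walkLength w p.reverse = walkLength w p := by
  simp [walkLength, Walk.edges_reverse, List.sum_reverse]

@[simp] lemma walkLength_transfer {u v : V} (p : G.Walk u v) {H : SimpleGraph V}
    (h : ∀ e ∈ p.edges, e ∈ H.edgeSet) : walkLength w (p.transfer H h) = walkLength w p := by
  simp [walkLength]

lemma walkLength_nonneg (hw : ∀ e ∈ G.edgeSet, 0 ≤ w e) {u v : V} (p : G.Walk u v) :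
    0 ≤ walkLength w p := by
  refine List.sum_nonneg ?_
  simp only [List.mem_map]
  rintro _ ⟨e, he, rfl⟩
  exact hw e (p.edges_subset_edgeSet he)

lemma walkLength_bypass_le [DecidableEq V] (hw : ∀ e ∈ G.edgeSet, 0 ≤ w e) {u v : V}
    (p : G.Walk u v) : walkLength w p.bypass ≤ walkLength w p := by
  obtain ⟨l, hl, hs⟩ := List.subperm_of_subset p.bypass_isPath.isTrail.edges_nodup
    p.edges_bypass_subset_edges
  rw [walkLength, ← (hl.map w).sum_eq]
  refine (hs.map w).sum_le_sum ?_
  simp only [List.mem_map]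
  rintro _ ⟨e, he, rfl⟩
  exact hw e (p.edges_subset_edgeSet he)

/-- The last step by which a walk enters a set `S` in which it ends. -/
lemma SimpleGraph.Walk.exists_last_entry (S : Set V) {a t : V} (q : G.Walk a t) (ht : t ∈ S) :
    (∀ x ∈ q.support, x ∈ S) ∨ ∃ (y z : V) (h : G.Adj y z) (q₁ : G.Walk a y) (q₂ : G.Walk z t),
      q = q₁.append (Walk.cons h q₂) ∧ y ∉ S ∧ ∀ x ∈ q₂.support, x ∈ S := by
  induction q with
  | nil => left; simpa using ht
  | @cons a b t h q ih =>
    rcases ih ht with hS | ⟨y, z, h', q₁, q₂, rfl, hy, hz⟩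
    · by_cases ha : a ∈ S
      · left; simpa [ha] using hS
      · exact .inr ⟨a, b, h, .nil, q, rfl, ha, hS⟩
    · exact .inr ⟨y, z, h', .cons h q₁, q₂, rfl, hy, hz⟩

/-- The graph without the vertices of `X` (which stay as isolated names). -/
def avoid (G : SimpleGraph V) (X : List V) : SimpleGraph V where
  Adj a b := G.Adj a b ∧ a ∉ X ∧ b ∉ X
  symm := ⟨fun _ _ h => ⟨h.1.symm, h.2.2, h.2.1⟩⟩
  loopless := ⟨fun _ h => G.irrefl h.1⟩

lemma avoid_le (G : SimpleGraph V) (X : List V) : avoid G X ≤ G := fun _ _ h => h.1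

lemma support_avoid {X : List V} {u t : V} (hu : u ∉ X) (p : (avoid G X).Walk u t) :
    ∀ x ∈ p.support, x ∉ X := by
  induction p with
  | nil => simpa using hu
  | cons h p ih =>
    simp only [Walk.support_cons, List.mem_cons, forall_eq_or_imp]
    exact ⟨hu, ih h.2.2⟩

lemma boundedPaths_avoid {X : List V} {u t : V} (hu : u ∉ X) (α : ℚ) :
    boundedPaths (avoid G X) w [] u t α = boundedPaths G w X u t α := by
  ext l
  constructor
  · rintro ⟨p, hp, hl, -, rfl⟩
    have he : ∀ e ∈ p.edges, e ∈ G.edgeSet := fun e he =>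
      edgeSet_mono (avoid_le G X) (p.edges_subset_edgeSet he)
    exact ⟨p.transfer G he, hp.transfer he, by simpa using hl,
      by simpa using support_avoid hu p, by simp⟩
  · rintro ⟨p, hp, hl, hX, rfl⟩
    have he : ∀ e ∈ p.edges, e ∈ (avoid G X).edgeSet := by
      intro e
      induction e with | _ a b => ?_
      intro he
      exact ⟨p.adj_of_mem_edges he, hX _ (p.fst_mem_support_of_mem_edges he),
        hX _ (p.snd_mem_support_of_mem_edges he)⟩
    exact ⟨p.transfer _ he, hp.transfer he, by simpa using hl, by simp, by simp⟩

lemma boundedPaths_nonempty [DecidableEq V] (hw : ∀ e ∈ G.edgeSet, 0 ≤ w e) {u t : V} {α : ℚ}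
    (q : G.Walk u t) (hq : walkLength w q ≤ α) : (boundedPaths G w [] u t α).Nonempty :=
  ⟨_, q.bypass, q.bypass_isPath, (walkLength_bypass_le hw q).trans hq, by simp, rfl⟩

lemma start_notMem_of_nonempty {X : List V} {u t : V} {α : ℚ}
    (h : (boundedPaths G w X u t α).Nonempty) : u ∉ X := by
  obtain ⟨_, p, -, -, hX, -⟩ := h
  exact hX _ p.start_mem_support

lemma end_notMem_of_nonempty {X : List V} {u t : V} {α : ℚ}
    (h : (boundedPaths G w X u t α).Nonempty) : t ∉ X := by
  obtain ⟨_, p, -, -, hX, -⟩ := h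
  exact hX _ p.end_mem_support

lemma head?_of_mem_boundedPaths {X : List V} {u t : V} {α : ℚ} {l : List V}
    (h : l ∈ boundedPaths G w X u t α) : l.head? = some u := by
  obtain ⟨p, -, -, -, rfl⟩ := h
  cases p <;> simp

lemma getLast?_of_mem_boundedPaths {X : List V} {u t : V} {α : ℚ} {l : List V}
    (h : l ∈ boundedPaths G w X u t α) : l.getLast? = some t := by
  obtain ⟨p, -, -, -, rfl⟩ := h
  rw [List.getLast?_eq_some_getLast (by simp)]
  simp

lemma nodup_of_mem_boundedPaths {X : List V} {u t : V} {α : ℚ} {l : List V}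
    (h : l ∈ boundedPaths G w X u t α) : l.Nodup := by
  obtain ⟨p, hp, -, -, rfl⟩ := h
  exact hp.support_nodup

/-- A bounded path to `t` from another vertex consists of its first edge and a bounded path that
avoids the first vertex. -/
lemma mem_boundedPaths_step {X : List V} {u t : V} {α : ℚ} {l : List V} (hut : u ≠ t) :
    l ∈ boundedPaths G w X u t α ↔ u ∉ X ∧ ∃ v l', G.Adj u v ∧ l = u :: l' ∧
      l' ∈ boundedPaths G w (u :: X) v t (α - w s(u, v)) := by
  constructor
  · rintro ⟨p, hp, hl, hX, rfl⟩
    cases p with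
    | nil => exact absurd rfl hut
    | @cons _ v _ h p =>
      rw [Walk.cons_isPath_iff] at hp
      simp only [Walk.support_cons, List.mem_cons, forall_eq_or_imp] at hX
      refine ⟨hX.1, v, p.support, h, by simp, p, hp.1, ?_, ?_, rfl⟩
      · rw [walkLength_cons] at hl; linarith
      · intro x hx
        simp only [List.mem_cons, not_or]
        exact ⟨fun h => hp.2 (h ▸ hx), hX.2 x hx⟩
  · rintro ⟨hu, v, _, h, rfl, p, hp, hl, hX, rfl⟩
    refine ⟨.cons h p, ?_, ?_, ?_, by simp⟩
    · rw [Walk.cons_isPath_iff]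
      exact ⟨hp, fun hx => hX _ hx (by simp)⟩
    · rw [walkLength_cons]; linarith
    · simp only [Walk.support_cons, List.mem_cons, forall_eq_or_imp]
      exact ⟨hu, fun x hx hx' => hX x hx (by simp [hx'])⟩

/-- The bounded paths that extend the path `q` correspond to the choices of a next vertex `v` and
of a path from there that avoids `q`, within the remaining bound. -/
lemma mem_boundedPaths_prefix {X : List V} {u u' t : V} {α : ℚ} (q : G.Walk u u') (hq : q.IsPath)
    (hX : ∀ x ∈ q.support, x ∉ X) (ht : t ∉ q.support) {l : List V} :
    (l ∈ boundedPaths G w X u t α ∧ q.support <+: l) ↔ ∃ v l', G.Adj u' v ∧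
      l = q.support ++ l' ∧ l' ∈ boundedPaths G w (q.support.reverse ++ X) v t
        (α - walkLength w q - w s(u', v)) := by
  induction q generalizing X α l with
  | @nil u =>
    have hut : ¬ t = u := by simpa using ht
    rw [mem_boundedPaths_step (Ne.symm hut)]
    have hX' := hX u (by simp)
    constructor
    · rintro ⟨⟨-, v, l', h1, rfl, h3⟩, -⟩
      exact ⟨v, l', h1, by simp, by simpa using h3⟩
    · rintro ⟨v, l', h1, rfl, h3⟩
      exact ⟨⟨hX', v, l', h1, by simp, by simpa using h3⟩, by simp⟩
  | @cons u b u' h q ih =>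
    simp only [Walk.support_cons, List.mem_cons, not_or, forall_eq_or_imp] at ht hX
    rw [Walk.cons_isPath_iff] at hq
    have hX' : ∀ x ∈ q.support, x ∉ u :: X := by
      intro x hx
      simp only [List.mem_cons, not_or]
      exact ⟨fun h => hq.2 (h ▸ hx), hX.2 x hx⟩
    rw [mem_boundedPaths_step (Ne.symm ht.1)]
    have ih' := fun l => ih (X := u :: X) (α := α - w s(u, b)) (l := l)
    have e1 : ∀ v, α - walkLength w (Walk.cons h q) - w s(u', v) =
        α - w s(u, b) - walkLength w q - w s(u', v) := by intro v; simp; ring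
    have e2 : (Walk.cons h q).support.reverse ++ X = q.support.reverse ++ (u :: X) := by simp
    simp only [e1, e2]
    constructor
    · rintro ⟨⟨-, v, l', h1, rfl, h3⟩, h4⟩
      rw [Walk.support_cons, List.cons_prefix_cons] at h4
      have hv : v = b := by
        obtain ⟨r, hr⟩ := h4.2
        have := head?_of_mem_boundedPaths h3
        rw [← hr, List.head?_append] at this
        cases q <;> simp at this <;> exact this.symm
      subst hv
      obtain ⟨v', l'', k1, rfl, k3⟩ := (ih' _ hq.1 hX' ht.2).1 ⟨h3, h4.2⟩
      exact ⟨v', l'', k1, by simp, k3⟩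
    · rintro ⟨v', l'', k1, rfl, k3⟩
      have := (ih' (q.support ++ l'') hq.1 hX' ht.2).2 ⟨v', l'', k1, rfl, k3⟩
      exact ⟨⟨hX.1, b, q.support ++ l'', h, by simp, this.1⟩, by simp⟩

end Walks

/-! ### Rooted forests -/

section Forests

open Relation

variable {V : Type}

/-- `Par p c` (`p` is the parent of `c`) is the parent relation of a rooted forest. Ancestors are
given by `ReflTransGen Par`, so that a vertex is an ancestor of itself. -/
structure IsForest (Par : V → V → Prop) : Prop where
  unique : ∀ {p p' c}, Par p c → Par p' c → p = p'
  depth : ∃ depth : V → ℕ, ∀ {p c}, Par p c → depth p < depth c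

namespace IsForest

variable {Par : V → V → Prop} (F : IsForest Par)
include F

lemma not_anc_parent {p c : V} (h : Par p c) : ¬ ReflTransGen Par c p := by
  obtain ⟨depth, hd⟩ := F.depth
  have key : ∀ {x y}, ReflTransGen Par x y → depth x ≤ depth y := by
    intro x y h
    induction h with
    | refl => exact le_rfl
    | tail _ h ih => exact ih.trans (hd h).le
  intro h'
  exact absurd (key h') (not_le.2 (hd h))

lemma anc_of_ne {p c x : V} (hp : Par p c) (h : ReflTransGen Par x c) (hx : x ≠ c) :
    ReflTransGen Par x p := by
  rcases ReflTransGen.cases_tail h with rfl | ⟨b, hb, hbc⟩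
  · exact absurd rfl hx
  · rwa [F.unique hp hbc]

lemma anc_total {x y z : V} (hx : ReflTransGen Par x z) (hy : ReflTransGen Par y z) :
    ReflTransGen Par x y ∨ ReflTransGen Par y x := by
  induction hx with
  | refl => exact .inr hy
  | tail h hbc ih =>
    rcases ReflTransGen.cases_tail hy with rfl | ⟨b, hb, hb'⟩
    · exact .inl (h.tail hbc)
    · rw [F.unique hb' hbc] at hb
      exact ih hb

lemma siblings_disjoint {v c c' y : V} (hc : Par v c) (hc' : Par v c') (hne : c ≠ c')
    (h : ReflTransGen Par c y) : ¬ ReflTransGen Par c' y := by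
  intro h'
  rcases F.anc_total h h' with k | k
  · exact F.not_anc_parent hc (F.anc_of_ne hc' k hne)
  · exact F.not_anc_parent hc' (F.anc_of_ne hc k hne.symm)

/-- A subtree is made up of the subtree of one child of the root and of the rest, which is reached
through the other children. -/
lemma anc_and_not_anc_iff {v next y : V} (hn : Par v next) :
    (ReflTransGen Par v y ∧ ¬ ReflTransGen Par next y) ↔
      y = v ∨ ∃ c, Par v c ∧ c ≠ next ∧ ReflTransGen Par c y := by
  constructor
  · rintro ⟨h, h'⟩
    rcases ReflTransGen.cases_head h with rfl | ⟨c, hc, hcy⟩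
    · exact .inl rfl
    · exact .inr ⟨c, hc, fun e => h' (e ▸ hcy), hcy⟩
  · rintro (rfl | ⟨c, hc, hne, hcy⟩)
    · exact ⟨.refl, F.not_anc_parent hn⟩
    · exact ⟨.head hc hcy, F.siblings_disjoint hc hn hne hcy⟩

lemma pairwise_anc {l : List V} (h : l.IsChain Par) :
    l.Pairwise fun x y => ReflTransGen Par x y ∧ ¬ ReflTransGen Par y x := by
  induction l with
  | nil => simp
  | cons a l ih =>
    cases l with
    | nil => simp
    | cons b l =>
      rw [List.isChain_cons_cons] at h
      have ih' := ih h.2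
      refine List.pairwise_cons.2 ⟨?_, ih'⟩
      have hb : ∀ x ∈ b :: l, ReflTransGen Par b x := by
        intro x hx
        rcases List.mem_cons.1 hx with rfl | hx
        · exact .refl
        · exact ((List.pairwise_cons.1 ih').1 x hx).1
      intro x hx
      exact ⟨.head h.1 (hb x hx), fun h' => F.not_anc_parent h.1 ((hb x hx).trans h')⟩

lemma nodup_of_isChain {l : List V} (h : l.IsChain Par) : l.Nodup :=
  (F.pairwise_anc h).imp fun {a b} h (e : a = b) => h.2 (e ▸ .refl)

end IsForest

/-! ### The tree routines -/

open Run

/-- After `k + 1` rounds the path has `k + 1` vertices unless it has reached the root before. -/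
lemma treePath_eq {parent : V → Option V} {u : V} {r : V → Prop} (hu : parent u = none)
    (hr : ∀ v, r v → v ≠ u → ∃ p, parent v = some p ∧ r p) (k : ℕ) {v : V} (hv : r v)
    (acc : List V) :
    ∃ l, (treePath parent (k + 1) v acc).val = l ++ v :: acc ∧
      (l ++ [v]).IsChain (fun p c => r c ∧ parent c = some p) ∧
      (∀ x ∈ l ++ [v], r x) ∧ (l.length = k ∨ (l ++ [v]).head? = some u) := by
  induction k generalizing v acc with
  | zero =>
    refine ⟨[], ?_, by simp, by simpa using hv, by simp⟩
    cases h : parent v <;> simp [treePath, h]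
  | succ k ih =>
    by_cases hvu : v = u
    · subst hvu
      exact ⟨[], by simp [treePath, hu], by simp, by simpa using hv, by simp⟩
    · obtain ⟨p, hp, hrp⟩ := hr v hv hvu
      obtain ⟨l, h1, h2, h3, h4⟩ := ih hrp (v :: acc)
      refine ⟨l ++ [p], ?_, ?_, ?_, ?_⟩
      · rw [treePath]
        simp only [bind_val, cons_val, op_val, hp, h1]
        simp
      · rw [List.append_assoc, List.isChain_append]
        rw [List.isChain_append] at h2
        refine ⟨h2.1, by simp [hv, hp], ?_⟩
        simpa using h2.2.2
      · intro x hx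
        rw [List.mem_append] at hx
        rcases hx with hx | hx
        · exact h3 x hx
        · rwa [List.mem_singleton.1 hx]
      · rcases h4 with h4 | h4
        · left; simp [h4]
        · right; simpa using h4

/-- With one round for each vertex, `treePath` reaches the root: the vertices that it visits are
distinct. -/
lemma treePath_spec {parent : V → Option V} {u : V} {r : V → Prop} (hu : parent u = none)
    (hr : ∀ v, r v → v ≠ u → ∃ p, parent v = some p ∧ r p) {verts : List V}
    (hverts : ∀ v, r v → v ∈ verts) (F : IsForest fun p c => c ∈ verts ∧ parent c = some p)
    {v : V} (hv : r v) :
    ∃ l, (treePath parent verts.length v []).val = l ∧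
      l.IsChain (fun p c => c ∈ verts ∧ parent c = some p) ∧ l.head? = some u ∧
      l.getLast? = some v := by
  obtain ⟨k, hk⟩ : ∃ k, verts.length = k + 1 :=
    Nat.exists_eq_succ_of_ne_zero (List.length_pos_of_mem (hverts v hv)).ne'
  obtain ⟨l, h1, h2, h3, h4⟩ := treePath_eq hu hr k hv []
  have h2' := h2.imp (S := fun p c => c ∈ verts ∧ parent c = some p)
    fun p c h => ⟨hverts c h.1, h.2⟩
  refine ⟨l ++ [v], by rw [hk, h1], h2', ?_, by simp⟩
  rcases h4 with h4 | h4
  · -- otherwise the parent of the first vertex would be one vertex too many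
    by_contra hne
    obtain ⟨a, l', hl'⟩ : ∃ a l', l ++ [v] = a :: l' := by
      cases l <;> simp
    rw [hl'] at hne h2' h3
    have ha := h3 a (by simp)
    obtain ⟨p, hp, hrp⟩ := hr a ha (by simpa using hne)
    have hchain : (p :: a :: l').IsChain (fun p c => c ∈ verts ∧ parent c = some p) :=
      List.isChain_cons_cons.2 ⟨⟨hverts a ha, hp⟩, h2'⟩
    have hsub : p :: a :: l' ⊆ verts := by
      intro x hx
      rcases List.mem_cons.1 hx with rfl | hx
      · exact hverts _ hrp
      · exact hverts _ (h3 x hx)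
    have hlen := (List.subperm_of_subset (F.nodup_of_isChain hchain) hsub).length_le
    have : (l ++ [v]).length = (a :: l').length := by rw [hl']
    simp at this hlen
    omega
  · exact h4

lemma treePath_within (parent : V → Option V) (k : ℕ) (v : V) (acc : List V) :
    Within (treePath parent k v acc) (2 * k) (4 * k) := by
  induction k generalizing v acc with
  | zero => exact Within.pure acc
  | succ k ih =>
    rw [treePath]
    refine ((Within.cons v acc).bind ((Within.op (parent v)).bind (τ' := 2 * k) (σ' := 4 * k)
      ?_)).mono (by omega) (by omega)
    simp only [op_val, cons_val]
    cases parent v with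
    | none => exact (Within.pure _).mono (by omega) (by omega)
    | some p => exact ih p _

variable [DecidableEq V]

lemma childLists_val (n : ℕ) (parent : V → Option V) (verts : List V) (x : V) :
    ((childLists n parent verts).val x) =
      (verts.filter fun v => decide (parent v = some x)).reverse := by
  have key : ∀ kids : V → List V, (loop (fun (kids : V → List V) v => (do
      match ← op (parent v) with
      | none => pure kids
      | some p =>
        let l ← cons v (kids p)
        op (Function.update kids p l) : Run (List V) (V → List V))) kids verts).val x =
      (verts.filter fun v => decide (parent v = some x)).reverse ++ kids x := by
    induction verts with
    | nil => intro kids; simp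
    | cons v verts ih =>
      intro kids
      rw [loop_cons]
      simp only [bind_val, op_val]
      rw [ih]
      cases h : parent v with
      | none => simp [h]
      | some p =>
        by_cases hp : p = x
        · subst hp; simp [h]
        · simp [h, hp, Function.update_of_ne (Ne.symm hp)]
  have := key fun _ => []
  rw [List.append_nil] at this
  exact this

lemma childLists_within (n : ℕ) (parent : V → Option V) (verts : List V) :
    Within (childLists n parent verts) (n + 4 * verts.length + 2) (n + 4 * verts.length) := by
  refine ((Within.newArray n _).bind (Within.loop_const (τ := 3) (σ := 4)
    (fun kids v _ => ?_) _)).mono (by omega) (by omega)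
  refine ((Within.op (parent v)).bind (τ' := 2) (σ' := 4) ?_).mono (by omega) (by omega)
  simp only [op_val]
  cases parent v with
  | none => exact (Within.pure _).mono (by omega) (by omega)
  | some p =>
    exact (Within.cons v (kids p)).bind (f := fun l => op (Function.update kids p l))
      (Within.op _)

omit [DecidableEq V] in
/-- The traversal visits the vertices of the subtrees on the stack, each once. -/
lemma subtrees_spec {Par : V → V → Prop} (F : IsForest Par) {verts : List V} {kids : V → List V}
    (hkids : ∀ x, (kids x).Nodup) (hmem : ∀ x y, y ∈ kids x ↔ Par x y)
    (hverts : ∀ x y, Par x y → y ∈ verts) (k : ℕ) (stack acc : List V)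
    (hstack : stack.Pairwise fun x y => ∀ a, ReflTransGen Par x a → ¬ ReflTransGen Par y a)
    (hsv : ∀ x ∈ stack, x ∈ verts) (hav : ∀ x ∈ acc, x ∈ verts) (hacc : acc.Nodup)
    (hdisj : ∀ a ∈ acc, ∀ x ∈ stack, ¬ ReflTransGen Par x a)
    (hk : verts.length + 1 ≤ k + acc.length) :
    (subtrees kids k stack acc).val.Nodup ∧ ∀ a, a ∈ (subtrees kids k stack acc).val ↔
      a ∈ acc ∨ ∃ x ∈ stack, ReflTransGen Par x a := by
  induction k generalizing stack acc with
  | zero =>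
    exfalso
    have := (List.subperm_of_subset hacc fun x hx => hav x hx).length_le
    omega
  | succ k ih =>
    cases stack with
    | nil => simp [subtrees, hacc]
    | cons x stack =>
      rw [List.pairwise_cons] at hstack
      have hxacc : x ∉ acc := fun h => hdisj x h x (by simp) .refl
      have := ih ((kids x).reverse ++ stack) (x :: acc) ?_ ?_ ?_ ?_ ?_ ?_
      · rw [subtrees]
        simp only [bind_val, cons_val, pushAll_val]
        refine ⟨this.1, fun a => (this.2 a).trans ?_⟩
        simp only [List.mem_cons, List.mem_append, List.mem_reverse, hmem, exists_eq_or_imp]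
        constructor
        · rintro ((rfl | h) | ⟨y, hy | hy, hya⟩)
          · exact .inr (.inl .refl)
          · exact .inl h
          · exact .inr (.inl (.head hy hya))
          · exact .inr (.inr ⟨y, hy, hya⟩)
        · rintro (h | h | ⟨y, hy, hya⟩)
          · exact .inl (.inr h)
          · rcases ReflTransGen.cases_head h with rfl | ⟨c, hc, hca⟩
            · exact .inl (.inl rfl)
            · exact .inr ⟨c, .inl hc, hca⟩
          · exact .inr ⟨y, .inr hy, hya⟩
      · rw [List.pairwise_append]
        refine ⟨?_, hstack.2, ?_⟩
        · refine List.Pairwise.imp_of_mem ?_ (List.nodup_reverse.2 (hkids x))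
          intro c c' hc hc' hne a h
          rw [List.mem_reverse, hmem] at hc hc'
          exact F.siblings_disjoint hc hc' hne h
        · intro c hc y hy a h
          rw [List.mem_reverse, hmem] at hc
          exact hstack.1 y hy a (.head hc h)
      · intro y hy
        rw [List.mem_append, List.mem_reverse, hmem] at hy
        exact hy.elim (hverts x y) fun h => hsv y (by simp [h])
      · intro y hy
        rcases List.mem_cons.1 hy with rfl | hy
        · exact hsv _ (by simp)
        · exact hav y hy
      · exact List.nodup_cons.2 ⟨hxacc, hacc⟩
      · intro a ha y hy h
        rw [List.mem_append, List.mem_reverse, hmem] at hy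
        rcases List.mem_cons.1 ha with rfl | ha
        · rcases hy with hy | hy
          · exact F.not_anc_parent hy h
          · exact hstack.1 y hy a .refl h
        · rcases hy with hy | hy
          · exact hdisj a ha x (by simp) (.head hy h)
          · exact hdisj a ha y (by simp [hy]) h
      · simp; omega

omit [DecidableEq V] in
/-- The cost of the traversal, charged to the visited vertices. -/
lemma subtrees_within (kids : V → List V) (k : ℕ) (stack acc : List V) :
    ∃ τ, τ + (acc.map fun x => 2 + 2 * (kids x).length).sum ≤
        ((subtrees kids k stack acc).val.map fun x => 2 + 2 * (kids x).length).sum + 1 ∧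
      Within (subtrees kids k stack acc) τ (4 * τ) := by
  induction k generalizing stack acc with
  | zero =>
    cases stack with
    | nil => exact ⟨1, by simp [subtrees]; omega, (Within.op acc).mono le_rfl (by omega)⟩
    | cons x stack => exact ⟨0, by simp [subtrees], Within.pure acc⟩
  | succ k ih =>
    cases stack with
    | nil => exact ⟨1, by simp [subtrees]; omega, (Within.op acc).mono le_rfl (by omega)⟩
    | cons x stack =>
      obtain ⟨τ, h1, h2⟩ := ih ((kids x).reverse ++ stack) (x :: acc)
      refine ⟨1 + ((2 * (kids x).length + 1) + τ), ?_, ?_⟩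
      · rw [subtrees]
        simp only [bind_val, cons_val, pushAll_val]
        simp only [List.map_cons, List.sum_cons] at h1
        omega
      · rw [subtrees]
        refine ((Within.cons x acc).bind ((Within.pushAll (kids x) stack).bind
          (τ' := τ) (σ' := 4 * τ) ?_)).mono le_rfl (by omega)
        simpa using h2

end Forests

/-! ### Shortest path forests -/

section ShortestPaths

open Relation SimpleGraph

variable {V : Type}

/-- `Par` is the parent relation of a forest in which the descendants of `u` form a shortest path
tree of the component of `u`, with distances `f`. -/
structure IsSPForest (H : SimpleGraph V) (w : Sym2 V → ℚ) (Par : V → V → Prop) (f : V → ℚ)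
    (u : V) : Prop extends IsForest Par where
  adj : ∀ {p c}, Par p c → H.Adj p c
  len : ∀ {p c}, Par p c → f c = f p + w s(p, c)
  root : f u = 0
  le : ∀ {x y} (q : H.Walk x y), ReflTransGen Par u x →
    ReflTransGen Par u y ∧ f y ≤ f x + walkLength w q

namespace IsSPForest

variable {H : SimpleGraph V} {w : Sym2 V → ℚ} {Par : V → V → Prop} {f : V → ℚ} {u : V}

lemma exists_walk_of_anc (D : IsSPForest H w Par f u) {x y : V} (h : ReflTransGen Par x y) :
    ∃ q : H.Walk x y, f x + walkLength w q = f y ∧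
      ∀ a ∈ q.support, ReflTransGen Par x a ∧ ReflTransGen Par a y := by
  induction h using ReflTransGen.head_induction_on with
  | refl => exact ⟨.nil, by simp, by simp; exact .refl⟩
  | @head x c hxc hcy ih =>
    obtain ⟨q, hq, hs⟩ := ih
    refine ⟨.cons (D.adj hxc) q, by rw [walkLength_cons, ← hq, D.len hxc]; ring, ?_⟩
    simp only [Walk.support_cons, List.mem_cons, forall_eq_or_imp]
    exact ⟨⟨.refl, .head hxc hcy⟩, fun a ha => ⟨.head hxc (hs a ha).1, (hs a ha).2⟩⟩

lemma exists_walk_of_isChain (D : IsSPForest H w Par f u) {a : V} {l : List V}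
    (h : (a :: l).IsChain Par) :
    ∃ (b : V) (q : H.Walk a b), q.IsPath ∧ q.support = a :: l ∧ f a + walkLength w q = f b := by
  have key : ∃ (b : V) (q : H.Walk a b), q.support = a :: l ∧ f a + walkLength w q = f b := by
    induction l generalizing a with
    | nil => exact ⟨a, .nil, by simp, by simp⟩
    | cons c l ih =>
      rw [List.isChain_cons_cons] at h
      obtain ⟨b, q, hs, hq⟩ := ih h.2
      refine ⟨b, .cons (D.adj h.1) q, by simp [hs], ?_⟩
      rw [walkLength_cons, ← hq, D.len h.1]; ring
  obtain ⟨b, q, hs, hq⟩ := key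
  exact ⟨b, q, (Walk.isPath_def q).2 (hs ▸ D.nodup_of_isChain h), hs, hq⟩

/-- An edge into the subtree of `next` which is not the tree edge `(v, next)` and is part of a
bounded walk gives a bounded walk that enters the subtree once, by an edge other than
`(v, next)`. If the walk from the edge to `t` leaves the subtree, its last entry is taken instead;
if that is by `(v, next)`, then the detour from `z` to `next` may be replaced by the tree path
between them, which is no longer and stays in the subtree. -/
lemma exists_single_entry (D : IsSPForest H w Par f u) {v next t x z : V} {α : ℚ}
    (hn : Par v next) (ht : ReflTransGen Par next t) (hv : ReflTransGen Par u v)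
    (hx : ReflTransGen Par u x) (hx' : ¬ ReflTransGen Par next x) (hz : ReflTransGen Par next z)
    (hxz : H.Adj x z) (hne : ¬ (x = v ∧ z = next)) (Q : H.Walk z t)
    (hα : f x + w s(x, z) + walkLength w Q ≤ α) (hw : ∀ e ∈ H.edgeSet, 0 ≤ w e) :
    ∃ (y y' : V) (_ : H.Adj y y') (q₁ : H.Walk u y) (q₂ : H.Walk y' t),
      (∀ a ∈ q₁.support, ¬ ReflTransGen Par next a) ∧
      (∀ a ∈ q₂.support, ReflTransGen Par next a) ∧ ¬ (y = v ∧ y' = next) ∧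
      walkLength w q₁ + w s(y, y') + walkLength w q₂ ≤ α := by
  have key : ∀ {y y' : V} (_ : H.Adj y y') (q₂ : H.Walk y' t), ReflTransGen Par u y →
      ¬ ReflTransGen Par next y → (∀ a ∈ q₂.support, ReflTransGen Par next a) →
      ¬ (y = v ∧ y' = next) → f y + w s(y, y') + walkLength w q₂ ≤ α →
      ∃ (y y' : V) (_ : H.Adj y y') (q₁ : H.Walk u y) (q₂ : H.Walk y' t),
      (∀ a ∈ q₁.support, ¬ ReflTransGen Par next a) ∧
      (∀ a ∈ q₂.support, ReflTransGen Par next a) ∧ ¬ (y = v ∧ y' = next) ∧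
      walkLength w q₁ + w s(y, y') + walkLength w q₂ ≤ α := by
    intro y y' hyy q₂ hy hy' hq₂ hne hle
    obtain ⟨q₁, hq₁, hs⟩ := D.exists_walk_of_anc hy
    rw [D.root] at hq₁
    exact ⟨y, y', hyy, q₁, q₂, fun a ha h => hy' (h.trans (hs a ha).2), hq₂, hne, by linarith⟩
  rcases Q.exists_last_entry {a | ReflTransGen Par next a} ht with
    hS | ⟨y, y', hyy, Q₁, Q₂, rfl, hy, hQ₂⟩
  · exact key hxz Q hx hx' hS hne hα
  · simp only [walkLength_append, walkLength_cons] at hα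
    by_cases hyn : y = v ∧ y' = next
    · obtain ⟨rfl, rfl⟩ := hyn
      obtain ⟨P, hP, hPs⟩ := D.exists_walk_of_anc hz
      have hQ₁ : f z ≤ f y + walkLength w Q₁ := by
        simpa using (D.le Q₁.reverse hv).2
      refine key hxz (P.reverse.append Q₂) hx hx' ?_ hne ?_
      · intro a ha
        rw [Walk.mem_support_append_iff, Walk.support_reverse, List.mem_reverse] at ha
        exact ha.elim (fun h => (hPs a h).1) (hQ₂ a)
      · have h0 := hw s(y, y') hyy
        have := D.len hn
        rw [walkLength_append, walkLength_reverse]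
        linarith
    · have h1 := (D.le (Walk.cons hxz Q₁) hx)
      rw [walkLength_cons] at h1
      exact key hyy Q₂ h1.1 hy hQ₂ hyn (by linarith [h1.2])

/-- In the situation of `exists_single_entry`, some bounded path does not start with the tree path
from `u` to `next`. -/
lemma exists_boundedPath_not_prefix [DecidableEq V] (D : IsSPForest H w Par f u)
    {v next t x z : V} {α : ℚ}
    (hn : Par v next) (ht : ReflTransGen Par next t) (hv : ReflTransGen Par u v)
    (hx : ReflTransGen Par u x) (hx' : ¬ ReflTransGen Par next x) (hz : ReflTransGen Par next z)
    (hxz : H.Adj x z) (hne : ¬ (x = v ∧ z = next)) (Q : H.Walk z t)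
    (hα : f x + w s(x, z) + walkLength w Q ≤ α) (hw : ∀ e ∈ H.edgeSet, 0 ≤ w e)
    {p : List V} (hp : p.getLast? = some v) (hp' : ∀ a ∈ p, ¬ ReflTransGen Par next a) :
    ∃ l ∈ boundedPaths H w [] u t α, ¬ p ++ [next] <+: l := by
  obtain ⟨y, y', hyy, q₁, q₂, h1, h2, hyn, hle⟩ :=
    D.exists_single_entry hn ht hv hx hx' hz hxz hne Q hα hw
  have h1' : ∀ a ∈ q₁.bypass.support, ¬ ReflTransGen Par next a := fun a ha =>
    h1 a (q₁.support_bypass_subset_support ha)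
  have h2' : ∀ a ∈ q₂.bypass.support, ReflTransGen Par next a := fun a ha =>
    h2 a (q₂.support_bypass_subset_support ha)
  have hsupp : (q₁.bypass.append (.cons hyy q₂.bypass)).support =
      q₁.bypass.support ++ q₂.bypass.support := by
    simp [Walk.support_append]
  refine ⟨_, ⟨q₁.bypass.append (.cons hyy q₂.bypass), ?_, ?_, by simp, rfl⟩, ?_⟩
  · rw [Walk.isPath_def, hsupp, List.nodup_append]
    exact ⟨q₁.bypass_isPath.support_nodup, q₂.bypass_isPath.support_nodup,
      fun a ha b hb hab => h1' a ha (hab ▸ h2' b hb)⟩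
  · have := walkLength_bypass_le hw q₁
    have := walkLength_bypass_le hw q₂
    rw [walkLength_append, walkLength_cons]
    linarith
  · rw [hsupp]
    rintro ⟨r, hr⟩
    rw [List.append_assoc, List.singleton_append] at hr
    -- both lists split at the first vertex in the subtree of `next`
    have hpq : p = q₁.bypass.support ∧ next :: r = q₂.bypass.support := by
      rcases List.append_eq_append_iff.1 hr with ⟨c, hc, hc'⟩ | ⟨c, hc, hc'⟩
      · cases c with
        | nil => exact ⟨by simpa using hc.symm, by simpa using hc'⟩
        | cons b c =>
          rw [List.cons_append, List.cons.injEq] at hc'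
          exact absurd .refl (h1' next (by rw [hc, hc'.1]; simp))
      · cases c with
        | nil => exact ⟨by simpa using hc, by simpa using hc'.symm⟩
        | cons b c =>
          exact absurd (h2' b (by rw [hc']; simp)) (hp' b (by rw [hc]; simp))
    refine hyn ⟨?_, ?_⟩
    · rw [hpq.1, List.getLast?_eq_some_getLast (by simp)] at hp
      simpa using hp
    · have := hpq.2
      rw [← Walk.cons_tail_support, List.cons.injEq] at this
      exact this.1.symm

/-- If no edge other than `(v, next)` that is part of a bounded walk enters the subtree of `next`,
then a bounded path that starts with the tree path to `v` continues with `next`. -/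
lemma prefix_append_next (D : IsSPForest H w Par f u) {g : V → ℚ} {v next t : V} {α : ℚ}
    (ht : ReflTransGen Par next t) (hnu : ¬ ReflTransGen Par next u)
    (hg : ∀ {z} (q : H.Walk z t), g z ≤ walkLength w q)
    (hJ : ∀ x z, ReflTransGen Par u x → ¬ ReflTransGen Par next x → ReflTransGen Par next z →
      H.Adj x z → f x + w s(x, z) + g z ≤ α → x = v ∧ z = next)
    {p l : List V} (hp : p.getLast? = some v) (hl : l ∈ boundedPaths H w [] u t α)
    (hpl : p <+: l) : p ++ [next] <+: l := by
  obtain ⟨q, hq, hle, -, rfl⟩ := hl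
  rcases q.exists_last_entry {a | ReflTransGen Par next a} ht with
    hS | ⟨y, y', hyy, Q₁, Q₂, rfl, hy, hQ₂⟩
  · exact absurd (hS u q.start_mem_support) hnu
  · have h1 := D.le Q₁ .refl
    rw [D.root, zero_add] at h1
    rw [walkLength_append, walkLength_cons] at hle
    obtain ⟨rfl, rfl⟩ := hJ y y' h1.1 hy (hQ₂ _ Q₂.start_mem_support) hyy
      (by linarith [h1.2, hg Q₂])
    have hnd := hq.support_nodup
    have hs : (Q₁.append (.cons hyy Q₂)).support = Q₁.support ++ Q₂.support := by
      simp [Walk.support_append]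
    rw [hs] at hnd hpl ⊢
    have hQ₁ : Q₁.support = Q₁.support.dropLast ++ [y] := by
      have := List.dropLast_append_getLast? (l := Q₁.support) y (by
        rw [List.getLast?_eq_some_getLast (by simp)]; simp)
      exact this.symm
    have hp1 : p = p.dropLast ++ [y] := (List.dropLast_append_getLast? y hp).symm
    -- `y` occurs only once on the path
    have : p = Q₁.support := by
      obtain ⟨r, hr⟩ := hpl
      rw [hp1, hQ₁] at hr
      rw [hQ₁] at hnd
      simp only [List.append_assoc, List.singleton_append] at hr hnd
      rw [hp1, hQ₁]
      rcases List.append_eq_append_iff.1 hr with ⟨c, hc, hc'⟩ | ⟨c, hc, hc'⟩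
      · cases c with
        | nil => simp [hc]
        | cons b c =>
          rw [List.cons_append, List.cons.injEq] at hc'
          rw [hc, ← hc'.1] at hnd
          exact absurd hnd (by simp [List.nodup_append])
      · cases c with
        | nil => simp [hc]
        | cons b c =>
          rw [List.cons_append, List.cons.injEq] at hc'
          rw [hc'.2] at hnd
          exact absurd hnd (by simp [List.nodup_append])
    rw [this, ← Walk.cons_tail_support Q₂]
    exact ⟨Q₂.support.tail, by simp⟩

end IsSPForest

/-! ### Shortest path trees as forests -/

/-- The parent relation of the vertices in `verts`. -/
def SPTree.Par (T : SPTree V) (verts : List V) (p c : V) : Prop :=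
  c ∈ verts ∧ T.parent c = some p

/-- The distance as a rational number, `0` for unreachable vertices. -/
def SPTree.len (T : SPTree V) (v : V) : ℚ := (T.dist v).untopD 0

lemma SPTree.coe_len {T : SPTree V} {v : V} (h : T.dist v ≠ ⊤) :
    (T.len v : WithTop ℚ) = T.dist v := by
  obtain ⟨q, hq⟩ := WithTop.ne_top_iff_exists.1 h
  rw [SPTree.len, ← hq]; rfl

variable {H : SimpleGraph V} {w : Sym2 V → ℚ} {verts : List V} {T : SPTree V} {u : V}

lemma mem_of_walk (hmem : ∀ a b, H.Adj a b → a ∈ verts) {x y : V} (q : H.Walk x y)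
    (hx : x ∈ verts) : y ∈ verts := by
  induction q with
  | nil => exact hx
  | cons h q ih => exact ih (hmem _ _ h.symm)

namespace SPTree.IsTree

lemma dist_ne_top (hT : T.IsTree verts H w u) {v : V} (hv : v ∈ verts) (q : H.Walk u v) :
    T.dist v ≠ ⊤ := by
  intro h
  have := (hT.dist_spec v hv).1 q
  rw [h, top_le_iff] at this
  exact WithTop.coe_ne_top this

lemma len_le (hT : T.IsTree verts H w u) {v : V} (hv : v ∈ verts) (q : H.Walk u v) :
    T.len v ≤ walkLength w q := by
  rw [← WithTop.coe_le_coe, SPTree.coe_len (hT.dist_ne_top hv q)]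
  exact (hT.dist_spec v hv).1 q

lemma exists_walk (hT : T.IsTree verts H w u) {v : V} (hv : v ∈ verts) (h : T.dist v ≠ ⊤) :
    ∃ q : H.Walk u v, walkLength w q = T.len v := by
  obtain ⟨q, hq⟩ := (hT.dist_spec v hv).2.resolve_left h
  rw [← SPTree.coe_len h, WithTop.coe_inj] at hq
  exact ⟨q, hq⟩

lemma isForest (hT : T.IsTree verts H w u) : IsForest (T.Par verts) where
  unique h h' := by
    have := h.2.symm.trans h'.2
    simpa using this
  depth := by
    obtain ⟨depth, hd⟩ := hT.acyclic
    exact ⟨depth, fun h => hd _ h.1 _ h.2⟩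

lemma par_spec (hT : T.IsTree verts H w u) (hmem : ∀ a b, H.Adj a b → a ∈ verts) {p c : V}
    (h : T.Par verts p c) : H.Adj p c ∧ p ∈ verts ∧ T.dist p ≠ ⊤ ∧ T.dist c ≠ ⊤ ∧
      T.len c = T.len p + w s(p, c) := by
  obtain ⟨hc, hp⟩ := h
  have hc' : T.dist c ≠ ⊤ := fun h => by simp [hT.unreached c hc h] at hp
  have hcu : c ≠ u := by rintro rfl; simp [hT.root] at hp
  obtain ⟨p', hp', hadj, hd⟩ := hT.reached c hc hcu hc'
  obtain rfl : p = p' := by rw [hp] at hp'; simpa using hp'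
  have hpt : T.dist p ≠ ⊤ := by
    intro h; rw [h, WithTop.top_add] at hd; exact hc' hd
  refine ⟨hadj, hmem _ _ hadj, hpt, hc', ?_⟩
  rw [← SPTree.coe_len hpt, ← SPTree.coe_len hc', ← WithTop.coe_add, WithTop.coe_inj] at hd
  exact hd

lemma anc_iff (hT : T.IsTree verts H w u) (hmem : ∀ a b, H.Adj a b → a ∈ verts)
    (hu : u ∈ verts) (v : V) :
    ReflTransGen (T.Par verts) u v ↔ v ∈ verts ∧ T.dist v ≠ ⊤ := by
  constructor
  · intro h
    cases h with
    | refl => exact ⟨hu, hT.dist_ne_top hu .nil⟩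
    | tail _ h => exact ⟨h.1, (hT.par_spec hmem h).2.2.2.1⟩
  · obtain ⟨depth, hd⟩ := hT.acyclic
    induction hk : depth v using Nat.strong_induction_on generalizing v with
    | _ k ih =>
      rintro ⟨hv, hv'⟩
      by_cases hvu : v = u
      · rw [hvu]
      · obtain ⟨p, hp, -, -⟩ := hT.reached v hv hvu hv'
        have hpar : T.Par verts p v := ⟨hv, hp⟩
        have hs := hT.par_spec hmem hpar
        exact (ih _ (hk ▸ hd v hv p hp) p rfl ⟨hs.2.1, hs.2.2.1⟩).tail hpar

lemma isSPForest (hT : T.IsTree verts H w u) (hmem : ∀ a b, H.Adj a b → a ∈ verts)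
    (hu : u ∈ verts) (hw : ∀ e ∈ H.edgeSet, 0 ≤ w e) :
    IsSPForest H w (T.Par verts) T.len u where
  toIsForest := hT.isForest
  adj h := (hT.par_spec hmem h).1
  len h := (hT.par_spec hmem h).2.2.2.2
  root := by
    obtain ⟨q, hq⟩ := hT.exists_walk hu (hT.dist_ne_top hu .nil)
    refine le_antisymm ?_ (hq ▸ walkLength_nonneg hw q)
    simpa using hT.len_le hu (.nil : H.Walk u u)
  le {x y} q hx := by
    rw [hT.anc_iff hmem hu] at hx
    obtain ⟨p, hp⟩ := hT.exists_walk hx.1 hx.2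
    have hy := mem_of_walk hmem q hx.1
    refine ⟨(hT.anc_iff hmem hu y).2 ⟨hy, hT.dist_ne_top hy (p.append q)⟩, ?_⟩
    have := hT.len_le hy (p.append q)
    rwa [walkLength_append, hp] at this

/-- The distance test of the algorithm decides whether there is a bounded path. -/
lemma dist_le_iff [DecidableEq V] {t : V} (hT : T.IsTree verts H w t)
    (hw : ∀ e ∈ H.edgeSet, 0 ≤ w e) (hu : u ∈ verts) (α : ℚ) :
    T.dist u ≤ (α : WithTop ℚ) ↔ (boundedPaths H w [] u t α).Nonempty := by
  constructor
  · intro h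
    have hne : T.dist u ≠ ⊤ := by
      intro h'; rw [h', top_le_iff] at h; exact WithTop.coe_ne_top h
    obtain ⟨q, hq⟩ := hT.exists_walk hu hne
    refine boundedPaths_nonempty hw q.reverse ?_
    rw [← SPTree.coe_len hne, WithTop.coe_le_coe] at h
    rwa [walkLength_reverse, hq]
  · rintro ⟨_, p, -, hp, -, -⟩
    refine ((hT.dist_spec u hu).1 p.reverse).trans ?_
    rwa [walkLength_reverse, WithTop.coe_le_coe]

end SPTree.IsTree

end ShortestPaths

/-! ### The longest common prefix -/

section Prefix

open Relation SimpleGraph Run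

variable {V : Type} [DecidableEq V]

@[simp] lemma setFlags_val (X : List V) (flag : V → Bool) (y : V) :
    (setFlags X flag).val y = (flag y || decide (y ∈ X)) := by
  rw [setFlags, loop_val]
  induction X generalizing flag with
  | nil => simp
  | cons x X ih =>
    rw [List.foldl_cons, ih]
    by_cases h : y = x
    · subst h; simp
    · simp [h]

lemma setFlags_within (X : List V) (flag : V → Bool) :
    Within (setFlags X flag) (2 * X.length + 1) 0 :=
  (Within.loop_const (fun _ _ _ => Within.op _) flag).mono (by omega) (by simp)

/-- The vertices that are flagged in the round of the tree edge `(v, next)`. -/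
def edgeBlock (kids : V → List V) (n : ℕ) (v next : V) : List V :=
  (subtrees kids n ((kids v).filter fun y => decide (y ≠ next)).reverse [v]).val

lemma edgeBlock_spec {Par : V → V → Prop} (F : IsForest Par) {verts : List V} {kids : V → List V}
    (hkids : ∀ x, (kids x).Nodup) (hmem : ∀ x y, y ∈ kids x ↔ Par x y)
    (hverts : ∀ x y, Par x y → y ∈ verts) {v next : V} (hv : v ∈ verts) (hn : Par v next) :
    (edgeBlock kids verts.length v next).Nodup ∧
      ∀ a, a ∈ edgeBlock kids verts.length v next ↔
        ReflTransGen Par v a ∧ ¬ ReflTransGen Par next a := by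
  have hmem' : ∀ x, x ∈ ((kids v).filter fun y => decide (y ≠ next)).reverse ↔
      Par v x ∧ x ≠ next := by simp [hmem]
  have := subtrees_spec F hkids hmem hverts verts.length
    ((kids v).filter fun y => decide (y ≠ next)).reverse [v] ?_ ?_ (by simpa using hv) (by simp)
    ?_ (by simp)
  · refine ⟨this.1, fun a => (this.2 a).trans ?_⟩
    rw [F.anc_and_not_anc_iff hn, List.mem_singleton]
    simp only [hmem', and_assoc]
  · refine List.Pairwise.imp_of_mem ?_ (List.nodup_reverse.2 ((hkids v).filter _))
    intro c c' hc hc' hne a h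
    exact F.siblings_disjoint ((hmem' c).1 hc).1 ((hmem' c').1 hc').1 hne h
  · intro x hx
    exact hverts v x ((hmem' x).1 hx).1
  · intro a ha x hx
    rw [List.mem_singleton.1 ha]
    exact F.not_anc_parent ((hmem' x).1 hx).1

/-- The test of `lcpLoop` for the tree edge `(v, next)`. -/
def edgeTest (H : AdjGraph V) (ds dt : V → WithTop ℚ) (α : ℚ) (v next : V) (block : List V)
    (flag : V → Bool) : Bool :=
  block.any fun x => (H.nbrs x).any fun e =>
    !flag e.1 && !(decide (x = v) && decide (e.1 = next)) &&
      decide (ds x + (e.2 : WithTop ℚ) + dt e.1 ≤ (α : WithTop ℚ))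

lemma lcpLoop_val_cons (H : AdjGraph V) (ds dt : V → WithTop ℚ) (kids : V → List V) (α : ℚ)
    (v next : V) (rest : List V) (flag : V → Bool) (acc : List V) :
    (lcpLoop H ds dt kids α (v :: next :: rest) flag acc).val =
      if edgeTest H ds dt α v next (edgeBlock kids H.verts.length v next)
          (setFlags (edgeBlock kids H.verts.length v next) flag).val then v :: acc
      else (lcpLoop H ds dt kids α (next :: rest)
        (setFlags (edgeBlock kids H.verts.length v next) flag).val (v :: acc)).val := by
  rw [lcpLoop]
  simp only [bind_val, cons_val, select_val, op_val, search_val]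
  rw [edgeTest, edgeBlock]
  split_ifs <;> rfl

/-- The cost of the main loop, charged to the vertices of the subtree of `v` (or any larger set):
each of them is in the block of at most one round, which visits its children and its neighbours. -/
lemma lcpLoop_within [Fintype V] {Par : V → V → Prop} (F : IsForest Par) {H : AdjGraph V}
    {kids : V → List V}
    (hkids : ∀ x, (kids x).Nodup) (hmem : ∀ x y, y ∈ kids x ↔ Par x y)
    (hverts : ∀ x y, Par x y → y ∈ H.verts) (hdeg : ∀ x, (kids x).length ≤ (H.nbrs x).length)
    (ds dt : V → WithTop ℚ) (α : ℚ) (v : V) (rest : List V) (flag : V → Bool) (acc : List V)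
    (hv : v ∈ H.verts) (hpath : (v :: rest).IsChain Par) (S : Finset V)
    (hS : ∀ a, ReflTransGen Par v a → a ∈ S) :
    Within (lcpLoop H ds dt kids α (v :: rest) flag acc)
      (∑ x ∈ S, (10 + 7 * (H.nbrs x).length)) (4 * ∑ x ∈ S, (10 + 7 * (H.nbrs x).length)) := by
  induction rest generalizing v flag acc S with
  | nil =>
    have h1 : 10 + 7 * (H.nbrs v).length ≤ ∑ x ∈ S, (10 + 7 * (H.nbrs x).length) :=
      Finset.single_le_sum (f := fun x => 10 + 7 * (H.nbrs x).length) (fun _ _ => Nat.zero_le _)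
        (hS v .refl)
    exact (Within.cons v acc).mono (by omega) (by omega)
  | cons next rest ih =>
    rw [List.isChain_cons_cons] at hpath
    obtain ⟨hn, hrest⟩ := hpath
    obtain ⟨hnd, hblock⟩ := edgeBlock_spec F hkids hmem hverts hv hn
    set block := edgeBlock kids H.verts.length v next with hb
    -- the block is disjoint from the set to which the remaining rounds are charged
    have ih' := fun flag acc => ih next flag acc (hverts _ _ hn) hrest (S \ block.toFinset)
      fun a ha => by
        rw [Finset.mem_sdiff, List.mem_toFinset, hblock]
        exact ⟨hS a (.head hn ha), fun h => h.2 ha⟩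
    have hsub : block.toFinset ⊆ S := by
      intro a ha
      rw [List.mem_toFinset, hblock] at ha
      exact hS a ha.1
    have hsum := Finset.sum_sdiff (f := fun x => 10 + 7 * (H.nbrs x).length) hsub
    rw [List.sum_toFinset _ hnd] at hsum
    obtain ⟨τ, h1, h2⟩ := subtrees_within kids H.verts.length
      ((kids v).filter fun y => decide (y ≠ next)).reverse [v]
    have hvb : v ∈ block := (hblock v).2 ⟨.refl, F.not_anc_parent hn⟩
    have e1 : ∀ l : List V, (l.map fun x => 10 + 7 * (H.nbrs x).length).sum =
        (l.map fun x => 2 + 2 * (H.nbrs x).length).sum + 2 * l.length +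
        (l.map fun x => (2 * (H.nbrs x).length + 1) + 1).sum +
        (l.map fun x => 4 + 3 * (H.nbrs x).length).sum := by
      intro l
      induction l with
      | nil => simp
      | cons a l ih => simp only [List.map_cons, List.sum_cons, List.length_cons, ih]; ring
    have e2 : ((block.map fun x => 2 + 2 * (kids x).length).sum) ≤
        (block.map fun x => 2 + 2 * (H.nbrs x).length).sum :=
      List.sum_le_sum fun x _ => by have := hdeg x; omega
    have e3 : 4 + 3 * (H.nbrs v).length ≤ (block.map fun x => 4 + 3 * (H.nbrs x).length).sum :=
      List.single_le_sum (by simp) _ (List.mem_map.2 ⟨v, hvb, rfl⟩)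
    have e4 := hdeg v
    have e5 : ((kids v).filter fun y => decide (y ≠ next)).length ≤ (kids v).length :=
      List.length_filter_le _ _
    change τ + _ ≤ (block.map _).sum + 1 at h1
    simp only [List.map_cons, List.map_nil, List.sum_cons, List.sum_nil] at h1
    rw [e1] at hsum
    rw [lcpLoop]
    have hsearch : Within (search (fun x => search (fun (e : V × ℚ) =>
        (op (!(setFlags block flag).val e.1 && !(decide (x = v) && decide (e.1 = next)) &&
          decide (ds x + (e.2 : WithTop ℚ) + dt e.1 ≤ (α : WithTop ℚ))) :
          Run (List V) Bool)) (H.nbrs x)) block)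
        ((block.map fun x => (2 * (H.nbrs x).length + 1) + 1).sum + 1) 0 := by
      refine (Within.search (τ := fun x => 2 * (H.nbrs x).length + 1) (σ := fun _ => 0)
        fun x _ => ?_).mono le_rfl (by simp)
      refine (Within.search (τ := fun _ => 1) (σ := fun _ => 0)
        fun e _ => Within.op _).mono ?_ (by simp)
      simp; omega
    refine ((Within.cons v acc).bind ((Within.select_op _ _).bind_of_val_eq (select_val _ _)
      ((Within.cons v []).bind (h2.bind_of_val_eq hb.symm ((setFlags_within _ _).bind (hsearch.bind
        (τ' := ∑ x ∈ S \ block.toFinset, (10 + 7 * (H.nbrs x).length))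
        (σ' := 4 * ∑ x ∈ S \ block.toFinset, (10 + 7 * (H.nbrs x).length)) ?_)))))).mono ?_ ?_
    · split_ifs
      · exact (Within.pure _).mono (by omega) (by omega)
      · exact ih' _ _
    · omega
    · omega

/-- The invariants of the main loop: `acc` is the reversed tree path from `u` to the parent of `v`;
every bounded path starts with this path and `v`; no edge except for the last one of this path
leads on a bounded walk into the subtree of `v` from outside; and exactly the vertices outside this
subtree are flagged. -/
lemma lcpLoop_spec {H : SimpleGraph V} {w : Sym2 V → ℚ} {Par : V → V → Prop} {f g : V → ℚ}
    {u t : V} (D : IsSPForest H w Par f u) (hw : ∀ e ∈ H.edgeSet, 0 ≤ w e) {B : AdjGraph V}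
    (hB : B.Represents H w) {kids : V → List V}
    (hkids : ∀ x, (kids x).Nodup) (hmem : ∀ x y, y ∈ kids x ↔ Par x y)
    (hverts : ∀ x y, Par x y → y ∈ B.verts) (hu : u ∈ B.verts) {ds dt : V → WithTop ℚ}
    (hds : ∀ x, ReflTransGen Par u x → ds x = f x) (hdt : ∀ x, ReflTransGen Par u x → dt x = g x)
    (hg : ∀ {z} (q : H.Walk z t), g z ≤ walkLength w q)
    (hg' : ∀ z, ReflTransGen Par u z → ∃ q : H.Walk z t, walkLength w q = g z)
    {α : ℚ} (v : V) (rest : List V) (flag : V → Bool) (acc : List V)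
    (hpath : (acc.reverse ++ v :: rest).IsChain Par)
    (htree : acc.reverse ++ v :: rest ∈ boundedPaths H w [] u t α)
    (hpre : ∀ l ∈ boundedPaths H w [] u t α, acc.reverse ++ [v] <+: l)
    (hin : ∀ x z, ReflTransGen Par u x → ¬ ReflTransGen Par v x → ReflTransGen Par v z →
      H.Adj x z → f x + w s(x, z) + g z ≤ α → z = v)
    (hflag : ∀ y, ReflTransGen Par u y → (flag y = true ↔ ¬ ReflTransGen Par v y)) :
    ∃ rev, (lcpLoop B ds dt kids α (v :: rest) flag acc).val = rev ∧ rev ≠ [] ∧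
      rev.reverse <+: acc.reverse ++ v :: rest ∧
      IsLongestCommonPrefix rev.reverse (boundedPaths H w [] u t α) := by
  induction rest generalizing v flag acc with
  | nil =>
    refine ⟨v :: acc, rfl, by simp, by simp, by simpa using hpre, ?_⟩
    intro ρ hρ
    simpa using (hρ _ htree).length_le
  | cons next rest ih =>
    have hchain := hpath
    rw [List.isChain_append] at hchain
    have hn : Par v next := (List.isChain_cons_cons.1 hchain.2.1).1
    have hpw := D.pairwise_anc hpath
    have huv : ReflTransGen Par u v ∧ ReflTransGen Par next t ∧
        ∀ a ∈ acc.reverse ++ [v], ¬ ReflTransGen Par next a := by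
      have h1 := head?_of_mem_boundedPaths htree
      have h2 := getLast?_of_mem_boundedPaths htree
      rw [List.pairwise_append, List.pairwise_cons, List.pairwise_cons] at hpw
      refine ⟨?_, ?_, ?_⟩
      · cases hacc : acc.reverse with
        | nil => rw [hacc] at h1; simp at h1; rw [h1]
        | cons b l =>
          rw [hacc] at h1; simp at h1
          rw [hacc] at hpw
          exact (hpw.2.2 u (by simp [h1]) v (by simp)).1
      · have ht : t ∈ next :: rest := by
          rw [List.getLast?_append, List.getLast?_cons_cons] at h2
          refine List.mem_of_getLast? ?_
          rw [← h2, List.getLast?_cons]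
          rfl
        rcases List.mem_cons.1 ht with rfl | ht
        · exact .refl
        · exact (hpw.2.1.2.1 t ht).1
      · intro a ha
        rcases List.mem_append.1 ha with ha | ha
        · exact (hpw.2.2 a ha next (by simp)).2
        · rw [List.mem_singleton.1 ha]; exact (hpw.2.1.1 next (by simp)).2
    obtain ⟨huv, hnt, hacc⟩ := huv
    have hv : v ∈ B.verts := by
      rcases ReflTransGen.cases_tail huv with rfl | ⟨b, -, hb⟩
      · exact hu
      · exact hverts _ _ hb
    have hnv : ¬ ReflTransGen Par next v := D.not_anc_parent hn
    obtain ⟨-, hblock⟩ := edgeBlock_spec D.toIsForest hkids hmem hverts hv hn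
    rw [lcpLoop_val_cons]
    set block := edgeBlock kids B.verts.length v next with hb
    -- for vertices reachable from `u`, being unflagged now means to be in the subtree of `next`
    have hflag' : ∀ y, ReflTransGen Par u y →
        ((setFlags block flag).val y = true ↔ ¬ ReflTransGen Par next y) := by
      intro y hy
      rw [setFlags_val, Bool.or_eq_true, hflag y hy, decide_eq_true_eq, hblock]
      constructor
      · rintro (h | h) h'
        · exact h (.head hn h')
        · exact h.2 h'
      · intro h
        by_cases h' : ReflTransGen Par v y
        · exact .inr ⟨h', h⟩
        · exact .inl h'
    have htest : edgeTest B ds dt α v next block (setFlags block flag).val = true ↔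
        ∃ x z, ReflTransGen Par v x ∧ ¬ ReflTransGen Par next x ∧ ReflTransGen Par next z ∧
          H.Adj x z ∧ ¬ (x = v ∧ z = next) ∧ f x + w s(x, z) + g z ≤ α := by
      have key : ∀ x z : V, ReflTransGen Par v x → H.Adj x z →
          (((!(setFlags block flag).val z && !(decide (x = v) && decide (z = next)) &&
            decide (ds x + (w s(x, z) : WithTop ℚ) + dt z ≤ (α : WithTop ℚ))) = true) ↔
          ReflTransGen Par next z ∧ ¬ (x = v ∧ z = next) ∧ f x + w s(x, z) + g z ≤ α) := by
        intro x z hx hxz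
        have hx' := huv.trans hx
        have hz' := (D.le (Walk.cons hxz .nil) hx').1
        have := hflag' z hz'
        rw [hds x hx', hdt z hz', ← WithTop.coe_add, ← WithTop.coe_add]
        rw [Bool.and_eq_true, Bool.and_eq_true, Bool.not_eq_true', Bool.not_eq_true',
          decide_eq_true_eq, WithTop.coe_le_coe, ← Bool.not_eq_true, this, not_not,
          ← Bool.not_eq_true, Bool.and_eq_true, decide_eq_true_eq, decide_eq_true_eq, and_assoc]
      simp only [edgeTest, List.any_eq_true, hblock]
      constructor
      · rintro ⟨x, ⟨hx, hx'⟩, ⟨z, q⟩, he, h⟩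
        have hxv : x ∈ B.verts := by
          rcases ReflTransGen.cases_tail hx with rfl | ⟨b, -, hb⟩
          · exact hv
          · exact hverts _ _ hb
        obtain ⟨hadj, rfl⟩ := (hB.mem_nbrs x hxv z q).1 he
        obtain ⟨k1, k2, k3⟩ := (key x z hx hadj).1 h
        exact ⟨x, z, hx, hx', k1, hadj, k2, k3⟩
      · rintro ⟨x, z, hx, hx', k1, hadj, k2, k3⟩
        exact ⟨x, ⟨hx, hx'⟩, (z, w s(x, z)),
          (hB.mem_nbrs x (hB.mem_verts x z hadj) z _).2 ⟨hadj, rfl⟩,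
          (key x z hx hadj).2 ⟨k1, k2, k3⟩⟩
    split_ifs with hfound
    -- a common prefix longer than the tree path to `v` would contain `next`, by the tree path to
    -- `t`, but not every bounded path goes there
    · obtain ⟨x, z, hx, hx', hz, hadj, hne, hle⟩ := htest.1 hfound
      obtain ⟨Q, hQ⟩ := hg' z ((huv.tail hn).trans hz)
      obtain ⟨l, hl, hnp⟩ := D.exists_boundedPath_not_prefix hn hnt huv (huv.trans hx) hx' hz hadj
        hne Q (α := α) (by rw [hQ]; exact hle) hw (p := acc.reverse ++ [v]) (by simp) hacc
      refine ⟨v :: acc, rfl, by simp, by simp, by simpa using hpre, fun ρ hρ => ?_⟩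
      by_contra hlen
      refine hnp (List.IsPrefix.trans (List.prefix_of_prefix_length_le (l₃ := acc.reverse ++
        v :: next :: rest) ⟨rest, by simp⟩ (hρ _ htree) ?_) (hρ l hl))
      simpa [Nat.succ_le_iff] using hlen
    · rw [htest] at hfound
      have hin' : ∀ x z, ReflTransGen Par u x → ¬ ReflTransGen Par next x →
          ReflTransGen Par next z → H.Adj x z → f x + w s(x, z) + g z ≤ α →
          x = v ∧ z = next := by
        intro x z hx hx' hz hadj hle
        by_cases hvx : ReflTransGen Par v x
        · by_contra hne
          exact hfound ⟨x, z, hvx, hx', hz, hadj, hne, hle⟩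
        · have := hin x z hx hvx (.head hn hz) hadj hle
          exact absurd (this ▸ hz) hnv
      have hnu : ¬ ReflTransGen Par next u := fun h => hnv (h.trans huv)
      obtain ⟨rev, h1, h2, h3, h4⟩ := ih next (setFlags block flag).val (v :: acc)
        (by simpa using hpath) (by simpa using htree) (fun l hl => by
          have := D.prefix_append_next hnt hnu hg hin' (by simp) hl (hpre l hl)
          simpa using this)
        (fun x z hx hx' hz hadj hle => (hin' x z hx hx' hz hadj hle).2) hflag'
      exact ⟨rev, h1, h2, by simpa using h3, h4⟩

end Prefix

/-! ### The graph of a call -/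

section Calls

open Relation SimpleGraph Run

variable {V : Type} [DecidableEq V]

lemma removeFlagged_verts (A : AdjGraph V) (flag : V → Bool) :
    (removeFlagged A flag).val.verts = (A.verts.filter fun v => !flag v).reverse := by
  simp [removeFlagged]

lemma removeFlagged_nbrs (A : AdjGraph V) (flag : V → Bool) (v : V) :
    (removeFlagged A flag).val.nbrs v = if v ∈ (removeFlagged A flag).val.verts then
      ((A.nbrs v).filter fun e => !flag e.1).reverse else [] := by
  have key : ∀ (l : List V) (nbrs : V → List (V × ℚ)), (loop (fun (nbrs : V → List (V × ℚ)) v =>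
      (do
        let l ← select (fun e => op (!flag e.1)) (A.nbrs v)
        op (Function.update nbrs v l) : Run (List V) (V → List (V × ℚ)))) nbrs l).val v =
      if v ∈ l then ((A.nbrs v).filter fun e => !flag e.1).reverse else nbrs v := by
    intro l
    induction l with
    | nil => simp
    | cons a l ih =>
      intro nbrs
      rw [loop_cons]
      simp only [bind_val, op_val]
      rw [ih]
      by_cases hv : v ∈ l
      · simp [hv]
      · by_cases ha : v = a
        · subst ha; simp [hv]
        · simp [hv, ha]
  exact key (removeFlagged A flag).val.verts fun _ => []

lemma removeFlagged_nbrs_length_le (A : AdjGraph V) (flag : V → Bool) (v : V) :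
    ((removeFlagged A flag).val.nbrs v).length ≤ (A.nbrs v).length := by
  rw [removeFlagged_nbrs]
  split_ifs
  · rw [List.length_reverse]; exact List.length_filter_le _ _
  · simp

lemma removeFlagged_represents {A : AdjGraph V} {G : SimpleGraph V} {w : Sym2 V → ℚ}
    (hA : A.Represents G w) {X : List V} {flag : V → Bool} (hflag : ∀ y, flag y = decide (y ∈ X)) :
    (removeFlagged A flag).val.Represents (avoid G X) w := by
  have hmem : ∀ v, v ∈ (removeFlagged A flag).val.verts ↔ v ∈ A.verts ∧ v ∉ X := by
    intro v; simp [removeFlagged_verts, hflag]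
  constructor
  · rw [removeFlagged_verts]
    exact List.nodup_reverse.2 (hA.verts_nodup.filter _)
  · intro u v h
    exact (hmem u).2 ⟨hA.mem_verts u v h.1, h.2.1⟩
  · intro u hu
    rw [removeFlagged_nbrs, if_pos hu]
    exact List.nodup_reverse.2 ((hA.nbrs_nodup u ((hmem u).1 hu).1).filter _)
  · intro u hu v q
    have hu' := (hmem u).1 hu
    rw [removeFlagged_nbrs, if_pos hu, List.mem_reverse, List.mem_filter,
      hA.mem_nbrs u hu'.1, hflag]
    simp only [Bool.not_eq_true', decide_eq_false_iff_not, avoid]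
    tauto

variable [Fintype V]

/-- The assumptions on the input graph and on the shortest path routine. -/
structure ValidInput (G : SimpleGraph V) (w : Sym2 V → ℚ) (A : AdjGraph V) (R : SSSPRoutine V)
    (tt : ℕ → ℕ → ℕ) (K : ℕ) : Prop where
  nonneg : ∀ e ∈ G.edgeSet, 0 ≤ w e
  mem_verts : ∀ v, v ∈ A.verts
  represents : A.Represents G w
  mono : ∀ n n' m m', n ≤ n' → m ≤ m' → tt n m ≤ tt n' m'
  solves : R.Solves tt K

namespace ValidInput

variable {G : SimpleGraph V} {w : Sym2 V → ℚ} {A : AdjGraph V} {R : SSSPRoutine V}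
  {tt : ℕ → ℕ → ℕ} {K : ℕ}

lemma sum_verts (hI : ValidInput G w A R tt K) (f : V → ℕ) :
    (A.verts.map f).sum = ∑ x, f x := by
  rw [← List.sum_toFinset f hI.represents.verts_nodup]
  congr 1
  ext x
  simp [hI.mem_verts x]

lemma length_verts (hI : ValidInput G w A R tt K) : A.verts.length = Fintype.card V := by
  have := hI.sum_verts fun _ => 1
  simpa using this

omit [DecidableEq V] [Fintype V] in
lemma nonneg_avoid (hI : ValidInput G w A R tt K) (X : List V) :
    ∀ e ∈ (avoid G X).edgeSet, 0 ≤ w e :=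
  fun e he => hI.nonneg e (edgeSet_mono (avoid_le G X) he)

lemma removeFlagged_within (hI : ValidInput G w A R tt K) (flag : V → Bool) :
    Within (removeFlagged A flag)
      (7 * Fintype.card V + 3 * ∑ x, (A.nbrs x).length + 3)
      (5 * Fintype.card V + 4 * ∑ x, (A.nbrs x).length) := by
  have hle : ∀ f : V → ℕ,
      ((A.verts.filter fun v => !flag v).reverse.map f).sum ≤ ∑ x, f x := by
    intro f
    rw [← hI.sum_verts, List.map_reverse, List.sum_reverse]
    exact (List.filter_sublist.map f).sum_le_sum (fun _ _ => Nat.zero_le _)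
  have h1 : Within (loop (fun (nbrs : V → List (V × ℚ)) v => (do
        let l ← select (fun e => op (!flag e.1)) (A.nbrs v)
        op (Function.update nbrs v l) : Run (List V) (V → List (V × ℚ)))) (fun _ => [])
        (A.verts.filter fun v => !flag v).reverse)
      (3 * Fintype.card V + 3 * (∑ x, (A.nbrs x).length) + 1)
      (4 * ∑ x, (A.nbrs x).length) := by
    refine (Within.loop (τ := fun v => 3 * (A.nbrs v).length + 2)
      (σ := fun v => 4 * (A.nbrs v).length) (fun nbrs v _ => ?_) _).mono ?_ ?_
    · exact (Within.select_op _ _).bind (f := fun l => op (Function.update nbrs v l))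
        (Within.op _)
    · refine add_le_add_left ((hle _).trans ?_) 1
      simp only [Finset.sum_add_distrib, ← Finset.mul_sum, Finset.sum_const, Finset.card_univ,
        smul_eq_mul]
      omega
    · refine (hle _).trans ?_
      rw [← Finset.mul_sum]
  have hn := hI.length_verts
  rw [removeFlagged]
  refine ((Within.select_op _ _).bind_of_val_eq (select_val _ _) ((Within.newArray _ _).bind
    (h1.bind (Within.pure _)))).mono ?_ ?_ <;> omega

end ValidInput

/-! ### Correctness and cost of the prefix computation -/

lemma lcp_spec {H : SimpleGraph V} {w : Sym2 V → ℚ} {B : AdjGraph V} {R : SSSPRoutine V}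
    {tt : ℕ → ℕ → ℕ} {K : ℕ} (hw : ∀ e ∈ H.edgeSet, 0 ≤ w e) (hB : B.Represents H w)
    (hR : R.Solves tt K) {u t : V} (hu : u ∈ B.verts) (ht : t ∈ B.verts) {α : ℚ}
    (hne : (boundedPaths H w [] u t α).Nonempty) (n : ℕ) :
    (∃ (u' : V) (q : H.Walk u u'), q.IsPath ∧
      (lcp R n B u t α).val = (q.support.reverse, walkLength w q) ∧
      IsLongestCommonPrefix q.support (boundedPaths H w [] u t α)) ∧
    Within (lcp R n B u t α)
      (2 * tt B.verts.length H.edgeSet.ncard + 6 * B.verts.length + 2 * n +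
        ∑ x, (10 + 7 * (B.nbrs x).length) + 4)
      (2 * (K * (B.verts.length + H.edgeSet.ncard)) + 8 * B.verts.length + 2 * n +
        4 * ∑ x, (10 + 7 * (B.nbrs x).length)) := by
  have hTs := hR.correct B H w hB hw u hu
  have hTt := hR.correct B H w hB hw t ht
  have hmem := hB.mem_verts
  set Ts := R.tree B u with hTs'
  set Tt := R.tree B t with hTt'
  have D := hTs.isSPForest hmem hu hw
  have hanc := hTs.anc_iff hmem hu
  obtain ⟨p₀, hp₀, hp₀α⟩ : ∃ p : H.Walk u t, p.IsPath ∧ walkLength w p ≤ α := by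
    obtain ⟨_, p, h1, h2, -⟩ := hne
    exact ⟨p, h1, h2⟩
  obtain ⟨path, hpath, hchain, hhead, hlast⟩ := treePath_spec (r := fun y => y ∈ B.verts ∧
    Ts.dist y ≠ ⊤) hTs.root (fun v hv hvu => by
      obtain ⟨p, hp, -, -⟩ := hTs.reached v hv.1 hvu hv.2
      have := hTs.par_spec hmem (p := p) (c := v) ⟨hv.1, hp⟩
      exact ⟨p, hp, this.2.1, this.2.2.1⟩) (fun v hv => hv.1) hTs.isForest (v := t)
    ((hanc t).1 (D.le p₀ .refl).1)
  obtain ⟨rest, rfl⟩ : ∃ rest, path = u :: rest := by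
    cases path with
    | nil => simp at hhead
    | cons a l => exact ⟨l, by simpa using hhead⟩
  set kids := (childLists n Ts.parent B.verts).val with hkids
  have hknodup : ∀ x, (kids x).Nodup := by
    intro x
    rw [hkids, childLists_val]
    exact List.nodup_reverse.2 (hB.verts_nodup.filter _)
  have hkmem : ∀ x y, y ∈ kids x ↔ Ts.Par B.verts x y := by
    intro x y
    rw [hkids, childLists_val]
    simp [SPTree.Par]
  have hdeg : ∀ x, (kids x).length ≤ (B.nbrs x).length := by
    intro x
    rw [← List.length_map (f := fun y => (y, w s(x, y)))]
    refine (List.subperm_of_subset ?_ ?_).length_le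
    · refine (hknodup x).map ?_
      intro a b hab
      exact (Prod.mk.inj hab).1
    · intro e he
      obtain ⟨y, hy, rfl⟩ := List.mem_map.1 he
      have := D.adj ((hkmem x y).1 hy)
      exact (hB.mem_nbrs x (hmem _ _ this) _ _).2 ⟨this, rfl⟩
  have htree : u :: rest ∈ boundedPaths H w [] u t α := by
    obtain ⟨b, q, hq, hs, hl⟩ := D.exists_walk_of_isChain hchain
    obtain rfl : b = t := by
      rw [← hs, List.getLast?_eq_some_getLast (by simp)] at hlast
      simpa using hlast
    refine ⟨q, hq, ?_, by simp, hs⟩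
    have := (D.le p₀ .refl).2
    linarith
  obtain ⟨rev, hrev, hrev0, hrevp, hlcp⟩ := lcpLoop_spec D hw hB hknodup hkmem
    (fun _ _ h => h.1) hu (ds := Ts.dist) (dt := Tt.dist) (g := Tt.len) (t := t) (α := α)
    (fun x hx => (SPTree.coe_len ((hanc x).1 hx).2).symm)
    (fun x hx => by
      obtain ⟨q, -⟩ := D.exists_walk_of_anc hx
      exact (SPTree.coe_len (hTt.dist_ne_top ((hanc x).1 hx).1 (p₀.reverse.append q))).symm)
    (fun {z} q => by
      simpa using hTt.len_le (mem_of_walk hmem q.reverse ht) q.reverse)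
    (fun z hz => by
      obtain ⟨q, -⟩ := D.exists_walk_of_anc hz
      have hz' := ((hanc z).1 hz).1
      obtain ⟨q', hq'⟩ := hTt.exists_walk hz' (hTt.dist_ne_top hz' (p₀.reverse.append q))
      exact ⟨q'.reverse, by simpa using hq'⟩)
    u rest (fun _ => false) [] hchain (by simpa using htree)
    (fun l hl => by
      have := head?_of_mem_boundedPaths hl
      cases l with
      | nil => simp at this
      | cons a l => simp at this; simp [this])
    (fun x z hx hx' => absurd hx hx') (fun y hy => by simp [hy])
  constructor
  · obtain ⟨l', hl'⟩ : ∃ l', rev.reverse = u :: l' := by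
      cases h : rev.reverse with
      | nil => simp at h; exact absurd h hrev0
      | cons a l =>
        rw [h] at hrevp
        simp at hrevp
        exact ⟨l, by rw [hrevp.1]⟩
    have hc' : (u :: l').IsChain (Ts.Par B.verts) := by
      rw [hl'] at hrevp
      obtain ⟨r, hr⟩ := hrevp
      rw [List.reverse_nil, List.nil_append] at hr
      have hc : (u :: rest).IsChain (Ts.Par B.verts) := hchain
      rw [← hr] at hc
      exact (List.isChain_append.1 hc).1
    obtain ⟨u', q, hq, hs, hl⟩ := D.exists_walk_of_isChain hc'
    have hrq : rev = q.support.reverse := by rw [hs, ← hl', List.reverse_reverse]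
    have hhd : rev.headD u = u' := by
      have h1 : q.support.getLast? = some u' := by
        rw [List.getLast?_eq_some_getLast (by simp)]; simp
      rw [← List.head?_reverse, ← hrq] at h1
      rw [List.headD_eq_head?_getD, h1]; rfl
    refine ⟨u', q, hq, ?_, ?_⟩
    · have : (lcp R n B u t α).val = (rev, (Ts.dist (rev.headD u)).untopD 0) := by
        rw [← hrev, ← hpath]; rfl
      rw [this, hhd]
      change (rev, Ts.len u') = _
      rw [← hl, D.root, zero_add, hrq]
    · rwa [hrq, List.reverse_reverse] at hlcp
  · have hloop := lcpLoop_within D.toIsForest hknodup hkmem (fun _ _ h => h.1) hdeg Ts.dist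
      Tt.dist α u rest (fun _ => false) [] hu hchain Finset.univ (fun _ _ => Finset.mem_univ _)
    have hrun : ∀ s ∈ B.verts, Within (R.run B s) (tt B.verts.length H.edgeSet.ncard)
        (K * (B.verts.length + H.edgeSet.ncard)) := fun s hs =>
      ⟨rfl, hR.time_le B H w hB hw s hs, hR.space_le B H w hB hw s hs,
        hR.space_le B H w hB hw s hs⟩
    rw [lcp]
    refine ((hrun u hu).bind ((hrun t ht).bind ((treePath_within _ _ _ _).bind_of_val_eq hpath
      ((childLists_within _ _ _).bind_of_val_eq hkids.symm ((Within.newArray n false).bind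
      (hloop.bind ((Within.op _).bind (Within.pure _)))))))).mono ?_ ?_ <;> omega

end Calls

/-! ### A call without its recursive calls -/

section Recursion

open SimpleGraph Run

variable {V : Type} [DecidableEq V] [Fintype V]

variable {G : SimpleGraph V} {w : Sym2 V → ℚ} {A : AdjGraph V} {R : SSSPRoutine V}
  {tt : ℕ → ℕ → ℕ} {K : ℕ} {t : V}

/-- What the recursion maintains for the arguments of a call. -/
structure GoodCall (G : SimpleGraph V) (w : Sym2 V → ℚ) (t : V) (c : Call V) : Prop where
  pre_nodup : c.pre.Nodup
  nonempty : (boundedPaths G w c.pre c.u t c.α).Nonempty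

namespace ValidInput

omit [Fintype V] in
lemma mem_removeFlagged_verts (hI : ValidInput G w A R tt K) {X : List V} {flag : V → Bool}
    (hflag : ∀ y, flag y = decide (y ∈ X)) (v : V) :
    v ∈ (removeFlagged A flag).val.verts ↔ v ∉ X := by
  simp [removeFlagged_verts, hflag, hI.mem_verts]

lemma removeFlagged_verts_length_le (hI : ValidInput G w A R tt K) (flag : V → Bool) :
    (removeFlagged A flag).val.verts.length ≤ Fintype.card V := by
  rw [removeFlagged_verts, List.length_reverse, ← hI.length_verts]
  exact List.length_filter_le _ _

omit [DecidableEq V] in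
lemma ncard_edgeSet_avoid_le (G : SimpleGraph V) (X : List V) :
    (avoid G X).edgeSet.ncard ≤ G.edgeSet.ncard :=
  Set.ncard_le_ncard (edgeSet_mono (avoid_le G X)) (Set.toFinite _)

lemma findPrefix_spec (hI : ValidInput G w A R tt K) {c : Call V} (hc : GoodCall G w t c) :
    (∃ (u' : V) (q : G.Walk c.u u'), q.IsPath ∧ (∀ x ∈ q.support, x ∉ c.pre) ∧
      (findPrefix R A t c).val = (q.support, u', walkLength w q) ∧
      IsLongestCommonPrefix q.support (boundedPaths G w c.pre c.u t c.α)) ∧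
    Within (findPrefix R A t c)
      (2 * tt (Fintype.card V) G.edgeSet.ncard + 40 * Fintype.card V +
        10 * (∑ x, (A.nbrs x).length) + 20)
      (2 * (K * (Fintype.card V + G.edgeSet.ncard)) + 70 * Fintype.card V +
        40 * (∑ x, (A.nbrs x).length) + 20) := by
  have hu := start_notMem_of_nonempty hc.nonempty
  have ht := end_notMem_of_nonempty hc.nonempty
  set flag := (setFlags c.pre fun _ => false).val with hflag
  have hflag' : ∀ y, flag y = decide (y ∈ c.pre) := fun y => by simp [hflag]
  set B := (removeFlagged A flag).val with hB
  have hne := hc.nonempty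
  rw [← boundedPaths_avoid hu] at hne
  obtain ⟨⟨u', q, hq, hval, hlcp⟩, hcost⟩ := lcp_spec (hI.nonneg_avoid c.pre)
    (removeFlagged_represents hI.represents hflag') hI.solves
    ((hI.mem_removeFlagged_verts hflag' c.u).2 hu) ((hI.mem_removeFlagged_verts hflag' t).2 ht)
    hne A.verts.length
  rw [← hB] at hval hcost
  have he : ∀ e ∈ q.edges, e ∈ G.edgeSet := fun e he =>
    edgeSet_mono (avoid_le G c.pre) (q.edges_subset_edgeSet he)
  have hhd : q.support.reverse.headD c.u = u' := by
    rw [List.headD_eq_head?_getD, List.head?_reverse,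
      List.getLast?_eq_some_getLast (by simp)]
    simp
  have hval' : (findPrefix R A t c).val = (q.support, u', walkLength w q) := by
    have : (findPrefix R A t c).val = ((lcp R A.verts.length B c.u t c.α).val.1.reverse ++ [],
      (lcp R A.verts.length B c.u t c.α).val.1.headD c.u,
      (lcp R A.verts.length B c.u t c.α).val.2) := by
      rw [← pushAll_val (O := List V)]; rfl
    rw [this, hval, hhd, List.reverse_reverse, List.append_nil]
  refine ⟨⟨u', q.transfer G he, hq.transfer he, ?_, ?_, ?_⟩, ?_⟩
  · simpa using support_avoid hu q
  · simpa using hval'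
  · rw [boundedPaths_avoid hu] at hlcp
    simpa using hlcp
  · have hlen : q.support.length ≤ Fintype.card V := hq.support_nodup.length_le_card
    have hpl : c.pre.length ≤ Fintype.card V := hc.pre_nodup.length_le_card
    have hn := hI.length_verts
    have hb := hI.removeFlagged_verts_length_le flag
    have hm := ncard_edgeSet_avoid_le G c.pre
    rw [← hB] at hb
    have htt := hI.mono _ _ _ _ hb hm
    have hK : K * (B.verts.length + (avoid G c.pre).edgeSet.ncard) ≤
        K * (Fintype.card V + G.edgeSet.ncard) := Nat.mul_le_mul_left K (add_le_add hb hm)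
    have hsum : ∑ x, (10 + 7 * (B.nbrs x).length) ≤
        10 * Fintype.card V + 7 * ∑ x, (A.nbrs x).length := by
      calc ∑ x, (10 + 7 * (B.nbrs x).length) ≤ ∑ x, (10 + 7 * (A.nbrs x).length) :=
            Finset.sum_le_sum fun x _ => by
              have : (B.nbrs x).length ≤ (A.nbrs x).length := removeFlagged_nbrs_length_le A flag x
              omega
        _ = _ := by
          simp only [Finset.sum_add_distrib, ← Finset.mul_sum, Finset.sum_const,
            Finset.card_univ, smul_eq_mul]
          ring
    have hpush : Within (pushAll q.support.reverse [] : Run (List V) (List V))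
        (2 * q.support.length + 1) (4 * q.support.length) := by
      simpa using Within.pushAll (O := List V) q.support.reverse []
    have hbody : Within (do
        let flag ← newArray A.verts.length false
        let flag ← setFlags c.pre flag
        let H ← removeFlagged A flag
        let r ← lcp R A.verts.length H c.u t c.α
        let π ← pushAll r.1 []
        pure (π, r.1.headD c.u, r.2) : Run (List V) (List V × V × ℚ)) _ _ :=
      (Within.newArray _ _).bind
        ((setFlags_within c.pre fun _ => false).bind_of_val_eq hflag.symm
        ((hI.removeFlagged_within flag).bind_of_val_eq hB.symm
        (hcost.bind_of_val_eq hval (hpush.bind (Within.pure _)))))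
    refine (hbody.proc fun r => 4 * r.1.length + 2).mono ?_ ?_
    · have hs : (findPrefix R A t c).val.1.length = q.support.length := by rw [hval']
      change _ + (4 * (findPrefix R A t c).val.1.length + 2) + 1 ≤ _
      omega
    · have hs : (findPrefix R A t c).val.1.length = q.support.length := by rw [hval']
      change _ + (4 * (findPrefix R A t c).val.1.length + 2) ≤ _
      omega

omit [DecidableEq V] [Fintype V] in
lemma loop_cons_filter_val (p : V × ℚ → Bool) (g : V × ℚ → Call V) (l : List (V × ℚ)) :
    (loop (fun cs e => (do
      let b ← op (p e)
      if b then cons (g e) cs else pure cs : Run (List V) (List (Call V)))) [] l).val =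
      ((l.filter p).map g).reverse := by
  have key : ∀ acc, (loop (fun cs e => (do
      let b ← op (p e)
      if b then cons (g e) cs else pure cs : Run (List V) (List (Call V)))) acc l).val =
      ((l.filter p).map g).reverse ++ acc := by
    induction l with
    | nil => simp
    | cons a l ih =>
      intro acc
      rw [loop_cons]
      simp only [bind_val, op_val]
      rw [ih]
      cases h : p a <;> simp [h]
  rw [key, List.append_nil]

lemma findChildren_spec (hI : ValidInput G w A R tt K) (u : V) (α : ℚ) {pre : List V}
    (hpre : pre.Nodup) (ht : t ∉ pre) :
    (∀ d, d ∈ (findChildren R A t u α pre).val ↔ ∃ v, G.Adj u v ∧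
      (boundedPaths G w pre v t (α - w s(u, v))).Nonempty ∧ d = ⟨v, α - w s(u, v), pre⟩) ∧
    (findChildren R A t u α pre).val.Pairwise (fun d d' => d.u ≠ d'.u) ∧
    (findChildren R A t u α pre).val.length ≤ (A.nbrs u).length ∧
    Within (findChildren R A t u α pre)
      (tt (Fintype.card V) G.edgeSet.ncard + 10 * Fintype.card V +
        10 * (∑ x, (A.nbrs x).length) + 10)
      (K * (Fintype.card V + G.edgeSet.ncard) + 10 * Fintype.card V +
        12 * (∑ x, (A.nbrs x).length) + 16) := by
  set flag := (setFlags pre fun _ => false).val with hflag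
  have hflag' : ∀ y, flag y = decide (y ∈ pre) := fun y => by simp [hflag]
  set B := (removeFlagged A flag).val with hB
  have hBr : B.Represents (avoid G pre) w := removeFlagged_represents hI.represents hflag'
  have htB : t ∈ B.verts := (hI.mem_removeFlagged_verts hflag' t).2 ht
  have hT := hI.solves.correct B _ w hBr (hI.nonneg_avoid pre) t htB
  set T := R.tree B t with hT'
  set p : V × ℚ → Bool := fun e =>
    !flag e.1 && decide (T.dist e.1 + (e.2 : WithTop ℚ) ≤ (α : WithTop ℚ)) with hp
  set g : V × ℚ → Call V := fun e => ⟨e.1, α - e.2, pre⟩ with hg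
  have hval : (findChildren R A t u α pre).val = (((A.nbrs u).filter p).map g).reverse := by
    rw [← loop_cons_filter_val]; rfl
  have hptest : ∀ v q, p (v, q) = true ↔ (boundedPaths G w pre v t (α - q)).Nonempty := by
    intro v q
    by_cases hv : v ∈ pre
    · have : p (v, q) = false := by simp [hp, hflag', hv]
      rw [this]
      exact ⟨fun h => by simp at h, fun h => absurd hv (start_notMem_of_nonempty h)⟩
    · rw [← boundedPaths_avoid hv, ← hT.dist_le_iff (hI.nonneg_avoid pre)
        ((hI.mem_removeFlagged_verts hflag' v).2 hv)]
      simp only [hp, hflag', hv, decide_false, Bool.not_false, Bool.true_and, decide_eq_true_eq]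
      cases hd : T.dist v with
      | top => simp
      | coe d =>
        rw [← WithTop.coe_add, WithTop.coe_le_coe, WithTop.coe_le_coe, le_sub_iff_add_le]
  have hmem := hI.represents.mem_nbrs u (hI.mem_verts u)
  have hlen : (findChildren R A t u α pre).val.length ≤ (A.nbrs u).length := by
    rw [hval, List.length_reverse, List.length_map]
    exact List.length_filter_le _ _
  refine ⟨fun d => ?_, ?_, hlen, ?_⟩
  · rw [hval, List.mem_reverse, List.mem_map]
    constructor
    · rintro ⟨⟨v, q⟩, he, rfl⟩
      rw [List.mem_filter, hmem, hptest] at he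
      obtain ⟨⟨hadj, rfl⟩, hne⟩ := he
      exact ⟨v, hadj, hne, rfl⟩
    · rintro ⟨v, hadj, hne, rfl⟩
      exact ⟨(v, w s(u, v)), List.mem_filter.2 ⟨(hmem _ _).2 ⟨hadj, rfl⟩, (hptest _ _).2 hne⟩,
        rfl⟩
  · rw [hval, List.pairwise_reverse, List.pairwise_map]
    refine List.Pairwise.imp_of_mem ?_
      ((hI.represents.nbrs_nodup u (hI.mem_verts u)).filter p)
    rintro ⟨v, q⟩ ⟨v', q'⟩ he he' hne (h : v' = v)
    have h1 := ((hmem _ _).1 (List.mem_of_mem_filter he)).2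
    have h2 := ((hmem _ _).1 (List.mem_of_mem_filter he')).2
    subst h
    exact hne (by rw [h1, h2])
  · have hn := hI.length_verts
    have hpl : pre.length ≤ Fintype.card V := hpre.length_le_card
    have hb : B.verts.length ≤ Fintype.card V := hI.removeFlagged_verts_length_le flag
    have hm := ncard_edgeSet_avoid_le G pre
    have htt := hI.mono _ _ _ _ hb hm
    have hK : K * (B.verts.length + (avoid G pre).edgeSet.ncard) ≤
        K * (Fintype.card V + G.edgeSet.ncard) := Nat.mul_le_mul_left K (add_le_add hb hm)
    have hdeg : (A.nbrs u).length ≤ ∑ x, (A.nbrs x).length :=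
      Finset.single_le_sum (f := fun x => (A.nbrs x).length) (fun _ _ => Nat.zero_le _)
        (Finset.mem_univ u)
    have hrun : Within (R.run B t) (tt B.verts.length (avoid G pre).edgeSet.ncard)
        (K * (B.verts.length + (avoid G pre).edgeSet.ncard)) :=
      ⟨rfl, hI.solves.time_le B _ w hBr (hI.nonneg_avoid pre) t htB,
        hI.solves.space_le B _ w hBr (hI.nonneg_avoid pre) t htB,
        hI.solves.space_le B _ w hBr (hI.nonneg_avoid pre) t htB⟩
    have hloop : Within (loop (fun cs e => (do
        let b ← op (p e)
        if b then cons (g e) cs else pure cs : Run (List V) (List (Call V)))) [] (A.nbrs u))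
        (3 * (A.nbrs u).length + 1) (4 * (A.nbrs u).length) := by
      refine (Within.loop_const (τ := 2) (σ := 4) (fun cs e _ => ?_) []).mono
        (by omega) (by omega)
      refine ((Within.op (p e)).bind (τ' := 1) (σ' := 4) ?_).mono le_rfl le_rfl
      split
      · exact Within.cons _ _
      · exact (Within.pure _).mono (by omega) (by omega)
    have hbody : Within (do
        let flag ← newArray A.verts.length false
        let flag ← setFlags pre flag
        let H ← removeFlagged A flag
        let T ← R.run H t
        loop (fun cs (e : V × ℚ) => do
          let b ← op (!flag e.1 && decide (T.dist e.1 + (e.2 : WithTop ℚ) ≤ (α : WithTop ℚ)))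
          if b then cons (⟨e.1, α - e.2, pre⟩ : Call V) cs else pure cs) [] (A.nbrs u) :
        Run (List V) (List (Call V))) _ _ :=
      (Within.newArray _ _).bind ((setFlags_within pre fun _ => false).bind_of_val_eq hflag.symm
        ((hI.removeFlagged_within flag).bind_of_val_eq hB.symm (hrun.bind hloop)))
    refine (hbody.proc fun cs => 4 * cs.length).mono ?_ ?_
    · change _ + (4 * (findChildren R A t u α pre).val.length) + 1 ≤ _
      omega
    · change _ + (4 * (findChildren R A t u α pre).val.length) ≤ _
      omega

omit [DecidableEq V] [Fintype V] in
lemma eq_of_prefix_of_end_mem {X : List V} {u : V} {α : ℚ} {l π : List V}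
    (hl : l ∈ boundedPaths G w X u t α) (hπ : π <+: l) (ht : t ∈ π) : l = π := by
  obtain ⟨r, rfl⟩ := hπ
  have h1 := getLast?_of_mem_boundedPaths hl
  have h2 := nodup_of_mem_boundedPaths hl
  cases r with
  | nil => simp
  | cons a r =>
    rw [List.getLast?_append_cons] at h1
    exact absurd rfl ((List.nodup_append.1 h2).2.2 t ht t (List.mem_of_getLast? h1))

/-- The effect of a call without its recursive calls. Either the prefix ends in `t` and is the only
bounded path, or the bounded paths are distributed to at least two recursive calls. -/
lemma callBody_spec (hI : ValidInput G w A R tt K) {c : Call V} (hc : GoodCall G w t c) :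
    ∃ (π : List V) (u' : V) (cs : List (Call V)), (callBody R A t c).val = (π, cs) ∧ u' ∈ π ∧
      π.getLast? = some u' ∧ (π.reverse ++ c.pre).Nodup ∧
      IsLongestCommonPrefix π (boundedPaths G w c.pre c.u t c.α) ∧
      (u' = t ∧ cs = [] ∧ boundedPaths G w c.pre c.u t c.α = {π} ∧
        (callBody R A t c).out = [c.pre.reverse ++ π] ∨
      2 ≤ cs.length ∧ cs.length ≤ (A.nbrs u').length ∧ (callBody R A t c).out = [] ∧
        cs.Pairwise (fun d d' => d.u ≠ d'.u) ∧
        (∀ d ∈ cs, GoodCall G w t d ∧ d.pre = π.reverse ++ c.pre) ∧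
        ∀ l, l ∈ boundedPaths G w c.pre c.u t c.α ↔
          ∃ d ∈ cs, ∃ l' ∈ boundedPaths G w d.pre d.u t d.α, l = π ++ l') ∧
      (callBody R A t c).time ≤ 3 * tt (Fintype.card V) G.edgeSet.ncard +
        60 * Fintype.card V + 20 * (∑ x, (A.nbrs x).length) + 50 ∧
      (callBody R A t c).net ≤ 8 * π.length + 2 + 4 * cs.length ∧
      (callBody R A t c).peak ≤ 3 * (K * (Fintype.card V + G.edgeSet.ncard)) +
        90 * Fintype.card V + 60 * (∑ x, (A.nbrs x).length) + 60 := by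
  obtain ⟨⟨u', q, hq, hqX, hval, hlcp⟩, hcost⟩ := hI.findPrefix_spec (R := R) hc
  set F := findPrefix R A t c with hF
  have hnet : F.net = 4 * q.support.length + 2 := by
    change 4 * F.val.1.length + 2 = _
    rw [hval]
  have hlast : q.support.getLast? = some u' := by
    rw [List.getLast?_eq_some_getLast (by simp)]; simp
  have hnd : (q.support.reverse ++ c.pre).Nodup := by
    rw [List.nodup_append]
    refine ⟨List.nodup_reverse.2 hq.support_nodup, hc.pre_nodup, fun a ha b hb hab => ?_⟩
    exact hqX a (List.mem_reverse.1 ha) (hab ▸ hb)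
  set pre := q.support.reverse ++ c.pre with hpre
  have hprel : pre.length ≤ Fintype.card V := hnd.length_le_card
  have hprel' : pre.length = q.support.length + c.pre.length := by simp [hpre]
  have hpush : Within (pushAll q.support c.pre : Run (List V) (List V))
      (2 * q.support.length + 1) (4 * q.support.length) := Within.pushAll _ _
  by_cases hut : u' = t
  · have hbody : callBody R A t c = F >>= fun r => pushAll r.1 c.pre >>= fun pre =>
        op r.2.1 >>= fun last => if last = t then
          (proc (fun _ => 0) (pushAll pre [] >>= fun π => emit π)) >>= fun _ => pure (r.1, [])
        else findChildren R A t last (c.α - r.2.2) pre >>= fun cs => pure (r.1, cs) := rfl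
    have hP := Within.pushAll (O := List V) pre []
    refine ⟨q.support, u', [], ?_, q.end_mem_support, hlast, hnd, hlcp,
      .inl ⟨hut, rfl, ?_, ?_⟩, ?_, ?_, ?_⟩
    · rw [hbody]; simp [hval, hut]
    · obtain ⟨l₀, hl₀⟩ := hc.nonempty
      have key : ∀ l ∈ boundedPaths G w c.pre c.u t c.α, l = q.support := fun l hl =>
        eq_of_prefix_of_end_mem hl (hlcp.1 l hl) (hut ▸ q.end_mem_support)
      ext l
      rw [Set.mem_singleton_iff]
      exact ⟨key l, fun h => by rw [h, ← key l₀ hl₀]; exact hl₀⟩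
    · rw [hbody]
      simp [hval, hut, hcost.out, hpush.out, (Within.pushAll _ _).out, emit]
    · rw [hbody]
      have h1 := hcost.time
      have h2 := hpush.time
      have h3 := hP.time
      simp only [bind_time, hval, op_val, op_time, hut, if_true, proc_time, pushAll_val, pure_time,
        emit, List.length_reverse, List.append_nil, ← hpre]
      omega
    · rw [hbody]
      have h2 := hpush.net
      simp only [bind_net, hval, op_val, op_net, hut, if_true, proc_net, pure_net, hnet,
        List.length_nil]
      omega
    · rw [hbody]
      have h1 := hcost.peak
      have h2 := hpush.peak
      have h2' := hpush.net
      have h3 := hP.peak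
      have h3' := hP.net
      have h4 := hcost.net
      simp only [bind_peak, hval, op_val, op_peak, op_net, hut, if_true, proc_peak, proc_net,
        pushAll_val, pure_peak, emit, ← hpre]
      omega
  · obtain ⟨l₀, hl₀⟩ := hc.nonempty
    have htq : t ∉ q.support := fun h => by
      have := eq_of_prefix_of_end_mem hl₀ (hlcp.1 l₀ hl₀) h
      have h1 := getLast?_of_mem_boundedPaths hl₀
      rw [this, hlast] at h1
      exact hut (Option.some.inj h1)
    have htpre : t ∉ pre := by
      rw [hpre, List.mem_append, List.mem_reverse, not_or]
      exact ⟨htq, end_notMem_of_nonempty hc.nonempty⟩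
    obtain ⟨hmem, hpw, hlen, hcc⟩ := hI.findChildren_spec (R := R) u' (c.α - walkLength w q) hnd
      htpre
    set cs := (findChildren R A t u' (c.α - walkLength w q) pre).val with hcs
    have hchild : ∀ l, l ∈ boundedPaths G w c.pre c.u t c.α ↔
        ∃ d ∈ cs, ∃ l' ∈ boundedPaths G w d.pre d.u t d.α, l = q.support ++ l' := by
      intro l
      rw [← and_iff_left_of_imp (hlcp.1 l), mem_boundedPaths_prefix q hq hqX htq]
      constructor
      · rintro ⟨v, l', hadj, rfl, hl'⟩
        exact ⟨_, (hmem _).2 ⟨v, hadj, ⟨l', hl'⟩, rfl⟩, l', hl', rfl⟩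
      · rintro ⟨d, hd, l', hl', rfl⟩
        obtain ⟨v, hadj, -, rfl⟩ := (hmem d).1 hd
        exact ⟨v, l', hadj, rfl, hl'⟩
    -- with one recursive call only, its vertex would extend the longest common prefix
    have htwo : 2 ≤ cs.length := by
      obtain ⟨d, hd, -⟩ := (hchild l₀).1 hl₀
      by_contra hlt
      obtain ⟨d', hd'⟩ : ∃ d', cs = [d'] := by
        have := List.length_pos_of_mem hd
        exact List.length_eq_one_iff.1 (by omega)
      have := hlcp.2 (q.support ++ [d'.u]) fun l hl => by
        obtain ⟨d, hd, l', hl', rfl⟩ := (hchild l).1 hl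
        rw [hd', List.mem_singleton] at hd
        subst hd
        have h1 := head?_of_mem_boundedPaths hl'
        cases l' with
        | nil => simp at h1
        | cons a l' =>
          simp only [List.head?_cons, Option.some.injEq] at h1
          rw [h1]
          exact ⟨l', by simp⟩
      simp at this
    have hbody : callBody R A t c = F >>= fun r => pushAll r.1 c.pre >>= fun pre =>
        op r.2.1 >>= fun last => if last = t then
          (proc (fun _ => 0) (pushAll pre [] >>= fun π => emit π)) >>= fun _ => pure (r.1, [])
        else findChildren R A t last (c.α - r.2.2) pre >>= fun cs => pure (r.1, cs) := rfl
    have hcost' : Within (callBody R A t c)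
        (3 * tt (Fintype.card V) G.edgeSet.ncard + 60 * Fintype.card V +
          20 * (∑ x, (A.nbrs x).length) + 50)
        (3 * (K * (Fintype.card V + G.edgeSet.ncard)) + 90 * Fintype.card V +
          60 * (∑ x, (A.nbrs x).length) + 60) := by
      rw [hbody]
      refine (hcost.bind_of_val_eq hval (hpush.bind_of_val_eq (pushAll_val _ _)
        ((Within.op u').bind_of_val_eq rfl
        (Within.ite_neg hut (hcc.bind (f := fun cs => pure (q.support, cs))
          (Within.pure _)))))).mono ?_ ?_ <;> omega
    refine ⟨q.support, u', cs, ?_, q.end_mem_support, hlast, hnd, hlcp,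
      .inr ⟨htwo, hlen, hcost'.out, hpw, ?_, hchild⟩, hcost'.time, ?_, hcost'.peak⟩
    · rw [hbody]; simp [hval, hut, hcs, hpre]
    · intro d hd
      obtain ⟨v, hadj, hne, rfl⟩ := (hmem d).1 hd
      exact ⟨⟨hnd, hne⟩, rfl⟩
    · rw [hbody]
      have h2 := hpush.net
      simp only [bind_net, hval, op_val, op_net, hut, if_false, pure_net, hnet, pushAll_val,
        ← hpre]
      have : (findChildren R A t u' (c.α - walkLength w q) pre).net = 4 * cs.length := rfl
      omega

end ValidInput

end Recursion

/-! ### The recursion -/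

section Listing

open SimpleGraph Run

namespace Run

variable {O α : Type}

lemma loop_unit_out (f : α → Run O Unit) (l : List α) :
    (loop (fun _ d => f d) () l).out = l.flatMap fun d => (f d).out := by
  induction l with
  | nil => rfl
  | cons a l ih => simp [loop_cons, ih]

lemma loop_unit_time (f : α → Run O Unit) (l : List α) :
    (loop (fun _ d => f d) () l).time = (l.map fun d => (f d).time + 1).sum + 1 := by
  induction l with
  | nil => rfl
  | cons a l ih => simp [loop_cons, ih]; omega

/-- When each round releases its memory, the peak of a loop is that of its worst round. -/
lemma loop_unit_peak_le (f : α → Run O Unit) (l : List α) (hnet : ∀ d ∈ l, (f d).net = 0)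
    {P : ℕ} (hP : ∀ d ∈ l, (f d).peak ≤ P) : (loop (fun _ d => f d) () l).peak ≤ P := by
  induction l with
  | nil => exact Nat.zero_le _
  | cons a l ih =>
    have h := ih (fun d hd => hnet d (by simp [hd])) fun d hd => hP d (by simp [hd])
    have h1 := hP a (by simp)
    simp [loop_cons, hnet a (by simp), h, h1]

end Run

variable {V : Type} [DecidableEq V] [Fintype V]

variable {G : SimpleGraph V} {w : Sym2 V → ℚ} {A : AdjGraph V} {R : SSSPRoutine V}
  {tt : ℕ → ℕ → ℕ} {K : ℕ} {t : V}

/-- The memory that calls hold during the recursion below them, charged to the vertices by which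
they extend the prefix: a bound for the part that is charged to vertices outside `X`. -/
def heldBound (A : AdjGraph V) (X : List V) : ℕ :=
  ∑ x ∈ Finset.univ \ X.toFinset, (26 + 4 * (A.nbrs x).length)

lemma heldBound_append (A : AdjGraph V) {π X : List V} (h : (π.reverse ++ X).Nodup) {u : V}
    (hu : u ∈ π) : heldBound A (π.reverse ++ X) + (26 * π.length + 4 * (A.nbrs u).length) ≤
      heldBound A X := by
  rw [List.nodup_append] at h
  have hπ : π.toFinset ⊆ Finset.univ \ X.toFinset := by
    intro x hx
    rw [List.mem_toFinset] at hx
    simp only [Finset.mem_sdiff, Finset.mem_univ, true_and, List.mem_toFinset]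
    exact fun hx' => h.2.2 x (List.mem_reverse.2 hx) x hx' rfl
  have h1 := Finset.sum_sdiff (f := fun x => 26 + 4 * (A.nbrs x).length) hπ
  have h2 : (Finset.univ \ X.toFinset) \ π.toFinset =
      Finset.univ \ (π.reverse ++ X).toFinset := by
    ext x
    simp only [Finset.mem_sdiff, Finset.mem_univ, true_and, List.mem_toFinset, List.mem_append,
      List.mem_reverse]
    tauto
  rw [h2, List.sum_toFinset _ (List.nodup_reverse.1 h.1)] at h1
  have h3 : ∀ l : List V, (l.map fun x => 26 + 4 * (A.nbrs x).length).sum =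
      26 * l.length + (l.map fun x => 4 * (A.nbrs x).length).sum := by
    intro l
    induction l with
    | nil => simp
    | cons a l ih => simp only [List.map_cons, List.sum_cons, List.length_cons, ih]; ring
  have h4 : 4 * (A.nbrs u).length ≤ (π.map fun x => 4 * (A.nbrs x).length).sum :=
    List.single_le_sum (by simp) _ (List.mem_map.2 ⟨u, hu, rfl⟩)
  rw [h3] at h1
  unfold heldBound
  omega

namespace ValidInput

/-- The output, time and memory of a call, where `k` is large enough for the depth of the recursion.
The time is at most `B` for each node of the recursion tree, so `B * (2 * γ - 1)` for `γ` leaves,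
since inner nodes have at least two children. The memory is that of a single call and of what the
calls on a branch hold. -/
lemma listPaths_spec (hI : ValidInput G w A R tt K) {B S : ℕ}
    (hB : 3 * tt (Fintype.card V) G.edgeSet.ncard + 60 * Fintype.card V +
      20 * (∑ x, (A.nbrs x).length) + 56 ≤ B)
    (hS : 3 * (K * (Fintype.card V + G.edgeSet.ncard)) + 90 * Fintype.card V +
        60 * (∑ x, (A.nbrs x).length) + 60 ≤ S) (k : ℕ) {c : Call V} (hc : GoodCall G w t c)
    (hk : Fintype.card V ≤ k + c.pre.length) :
    (listPaths R A t k c).net = 0 ∧ (listPaths R A t k c).out.Nodup ∧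
      (∀ l, l ∈ (listPaths R A t k c).out ↔
        ∃ l' ∈ boundedPaths G w c.pre c.u t c.α, l = c.pre.reverse ++ l') ∧
      (listPaths R A t k c).time + B ≤ 2 * B * (listPaths R A t k c).out.length ∧
      (listPaths R A t k c).peak ≤ S + heldBound A c.pre := by
  induction k generalizing c with
  | zero =>
    -- the prefix would contain all vertices, but `c.u` is not in it
    have hnd : (c.u :: c.pre).Nodup :=
      List.nodup_cons.2 ⟨start_notMem_of_nonempty hc.nonempty, hc.pre_nodup⟩
    have := hnd.length_le_card
    simp at this
    omega
  | succ k ih =>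
    obtain ⟨π, u', cs, hval, hu', hlast, hnd, -, hcase, htime, hnet, hpeak⟩ :=
      hI.callBody_spec (R := R) hc
    have hheld := heldBound_append A hnd hu'
    have hπ : 1 ≤ π.length := List.length_pos_of_mem hu'
    have hbody : listPaths R A t (k + 1) c = proc (fun _ => 0) (callBody R A t c >>= fun r =>
        loop (fun _ d => listPaths R A t k d) () r.2) := rfl
    have hout : (listPaths R A t (k + 1) c).out =
        (callBody R A t c).out ++ cs.flatMap fun d => (listPaths R A t k d).out := by
      rw [hbody, proc_out, bind_out, hval, loop_unit_out]
    have htime' : (listPaths R A t (k + 1) c).time =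
        (callBody R A t c).time +
          ((cs.map fun d => (listPaths R A t k d).time + 1).sum + 1) + 0 + 1 := by
      rw [hbody, proc_time, bind_time, hval, loop_unit_time]
    have hpeak' : (listPaths R A t (k + 1) c).peak =
        16 + max (callBody R A t c).peak ((callBody R A t c).net +
          (loop (fun _ d => listPaths R A t k d) () cs).peak) + 0 := by
      rw [hbody, proc_peak, bind_peak, hval]
    refine ⟨rfl, ?_⟩
    rcases hcase with ⟨-, rfl, hset, hout'⟩ | ⟨htwo, hlen, hout', hpw, hgood, hsplit⟩
    · rw [hout, htime', hpeak', hset, hout']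
      refine ⟨by simp, by simp, ?_, ?_⟩
      · simp; omega
      · have : (loop (fun _ d => listPaths R A t k d) () ([] : List (Call V))).peak = 0 := rfl
        rw [this]
        simp only [List.length_nil] at hnet
        omega
    · have ihd : ∀ d ∈ cs, _ := fun d hd => ih (hgood d hd).1 (by
        rw [(hgood d hd).2, List.length_append, List.length_reverse]; omega)
      rw [hout, htime', hpeak', hout', List.nil_append]
      refine ⟨?_, ?_, ?_, ?_⟩
      · rw [List.nodup_flatMap]
        refine ⟨fun d hd => (ihd d hd).2.1, List.Pairwise.imp_of_mem ?_ hpw⟩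
        intro d d' hd hd' hne l hl hl'
        obtain ⟨l₁, h₁, rfl⟩ := ((ihd d hd).2.2.1 l).1 hl
        obtain ⟨l₂, h₂, h⟩ := ((ihd d' hd').2.2.1 _).1 hl'
        rw [(hgood d hd).2, (hgood d' hd').2, List.append_cancel_left_eq] at h
        have h3 := head?_of_mem_boundedPaths h₁
        rw [h, head?_of_mem_boundedPaths h₂] at h3
        exact hne (Option.some.inj h3).symm
      · intro l
        rw [List.mem_flatMap]
        constructor
        · rintro ⟨d, hd, hl⟩
          obtain ⟨l', hl', rfl⟩ := ((ihd d hd).2.2.1 l).1 hl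
          exact ⟨π ++ l', (hsplit _).2 ⟨d, hd, l', hl', rfl⟩, by simp [(hgood d hd).2]⟩
        · rintro ⟨l', hl', rfl⟩
          obtain ⟨d, hd, l'', hl'', rfl⟩ := (hsplit _).1 hl'
          exact ⟨d, hd, ((ihd d hd).2.2.1 _).2 ⟨l'', hl'', by simp [(hgood d hd).2]⟩⟩
      · have hsum : ∀ l : List (Call V), (∀ d ∈ l, d ∈ cs) →
            (l.map fun d => (listPaths R A t k d).time + 1).sum + l.length * B ≤
            2 * B * (l.flatMap fun d => (listPaths R A t k d).out).length + l.length := by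
          intro l
          induction l with
          | nil => simp
          | cons d l ihl =>
            intro hl
            have h1 := (ihd d (hl d (by simp))).2.2.2.1
            have h2 := ihl fun d hd => hl d (by simp [hd])
            simp only [List.map_cons, List.sum_cons, List.flatMap_cons, List.length_append,
              List.length_cons, mul_add, add_mul, one_mul]
            omega
        have h := hsum cs fun _ hd => hd
        -- the second and every further child leave room for the cost of this call
        obtain ⟨j, hj⟩ := Nat.exists_eq_add_of_le htwo
        rw [hj] at h
        have hjB : j ≤ j * B := Nat.le_mul_of_pos_right j (by omega)
        rw [add_mul] at h
        omega
      · have hloop := loop_unit_peak_le (fun d => listPaths R A t k d) cs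
          (fun d hd => (ihd d hd).1) (P := S + heldBound A (π.reverse ++ c.pre))
          (fun d hd => (hgood d hd).2 ▸ (ihd d hd).2.2.2.2)
        omega

lemma goodCall_of_reachable (hI : ValidInput G w A R tt K) {c₀ c : Call V}
    (h₀ : GoodCall G w t c₀) (h : Relation.ReflTransGen (IsChildCall R A t) c₀ c) :
    GoodCall G w t c := by
  induction h with
  | refl => exact h₀
  | @tail c d _ hcd ih =>
    obtain ⟨π, u', cs, hval, -, -, -, -, hcase, -⟩ := hI.callBody_spec (R := R) ih
    rw [IsChildCall, hval] at hcd
    rcases hcase with ⟨-, rfl, -⟩ | ⟨-, -, -, -, hgood, -⟩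
    · simp at hcd
    · exact (hgood d hcd).1

lemma sum_nbrs_le (hI : ValidInput G w A R tt K) :
    ∑ x, (A.nbrs x).length ≤ 2 * G.edgeSet.ncard := by
  classical
  rw [← SimpleGraph.coe_edgeFinset, Set.ncard_coe_finset, ← G.sum_degrees_eq_twice_card_edges]
  refine Finset.sum_le_sum fun x _ => ?_
  have hmem := hI.represents.mem_nbrs x (hI.mem_verts x)
  have hnd : ((A.nbrs x).map Prod.fst).Nodup := by
    refine (List.nodup_map_iff_inj_on (hI.represents.nbrs_nodup x (hI.mem_verts x))).2 ?_
    rintro ⟨v, q⟩ h ⟨v', q'⟩ h' (rfl : v = v')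
    rw [((hmem _ _).1 h).2, ((hmem _ _).1 h').2]
  rw [← List.length_map (f := Prod.fst), ← List.toFinset_card_of_nodup hnd,
    ← G.card_neighborFinset_eq_degree]
  refine Finset.card_le_card fun v hv => ?_
  rw [List.mem_toFinset, List.mem_map] at hv
  obtain ⟨⟨v', q⟩, h, rfl⟩ := hv
  rw [SimpleGraph.mem_neighborFinset]
  exact ((hmem _ _).1 h).1

lemma size_eq (hI : ValidInput G w A R tt K) :
    A.size = 5 * Fintype.card V + 4 * ∑ x, (A.nbrs x).length := by
  rw [AdjGraph.size, hI.sum_verts]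
  simp only [Finset.sum_add_distrib, ← Finset.mul_sum, Finset.sum_const, Finset.card_univ,
    smul_eq_mul]
  ring

/-- The output, time and memory of the whole algorithm, in terms of the numbers of vertices and of
adjacency list entries. -/
lemma listAllPaths_spec (hI : ValidInput G w A R tt K) {B S : ℕ}
    (hB : 3 * tt (Fintype.card V) G.edgeSet.ncard + 60 * Fintype.card V +
      20 * (∑ x, (A.nbrs x).length) + 56 ≤ B)
    (hS : 3 * (K * (Fintype.card V + G.edgeSet.ncard)) + 90 * Fintype.card V +
        60 * (∑ x, (A.nbrs x).length) + 60 ≤ S) (s t : V) (α : ℚ) :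
    (listAllPaths R A s t α).out.Nodup ∧
      (∀ l, l ∈ (listAllPaths R A s t α).out ↔ l ∈ boundedPaths G w [] s t α) ∧
      (listAllPaths R A s t α).time ≤ B * (1 + 2 * (listAllPaths R A s t α).out.length) ∧
      (listAllPaths R A s t α).peak ≤
        1 + S + 26 * Fintype.card V + 4 * ∑ x, (A.nbrs x).length := by
  have ht := hI.mem_verts t
  have hT := hI.solves.correct A G w hI.represents hI.nonneg t ht
  have hn := hI.length_verts
  have htime := hI.solves.time_le A G w hI.represents hI.nonneg t ht
  have hspace := hI.solves.space_le A G w hI.represents hI.nonneg t ht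
  rw [hn] at htime hspace
  set b : Run (List V) Bool := proc (fun _ => 1) (R.run A t >>= fun T =>
    op (decide (T.dist s ≤ (α : WithTop ℚ)))) with hb
  have hbval : b.val = decide ((R.tree A t).dist s ≤ (α : WithTop ℚ)) := rfl
  have hbtime : b.time = R.time A t + 1 + 1 + 1 := rfl
  have hbnet : b.net = 1 := rfl
  have hbpeak : b.peak = 16 + max (R.space A t) (R.space A t + 0) + 1 := rfl
  have hbout : b.out = [] := rfl
  have hbody : listAllPaths R A s t α = b >>= fun b =>
      if b then listPaths R A t A.verts.length ⟨s, α, []⟩ else pure () := rfl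
  by_cases hd : (R.tree A t).dist s ≤ (α : WithTop ℚ)
  · have hc : GoodCall G w t ⟨s, α, []⟩ :=
      ⟨List.nodup_nil, (hT.dist_le_iff hI.nonneg (hI.mem_verts s) α).1 hd⟩
    obtain ⟨h1, h2, h3, h4, h5⟩ := hI.listPaths_spec hB hS A.verts.length hc
      (by simp [hn])
    have hheld : heldBound A ([] : List V) =
        26 * Fintype.card V + 4 * ∑ x, (A.nbrs x).length := by
      simp only [heldBound, List.toFinset_nil, Finset.sdiff_empty, Finset.sum_add_distrib,
        ← Finset.mul_sum, Finset.sum_const, Finset.card_univ, smul_eq_mul]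
      ring
    rw [hbody, bind_out, bind_time, bind_peak, hbval, hbout, hbtime, hbnet, hbpeak,
      decide_eq_true hd, if_pos rfl, List.nil_append]
    refine ⟨h2, fun l => (h3 l).trans (by simp), ?_, ?_⟩
    · rw [mul_add, mul_one, ← mul_assoc, mul_comm B 2]
      omega
    · rw [hheld] at h5
      omega
  · have hempty : ∀ l, l ∉ boundedPaths G w [] s t α := fun l hl =>
      hd ((hT.dist_le_iff hI.nonneg (hI.mem_verts s) α).2 ⟨l, hl⟩)
    rw [hbody, bind_out, bind_time, bind_peak, hbval, hbout, hbtime, hbnet, hbpeak,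
      decide_eq_false hd]
    refine ⟨by simp, fun l => by simp [hempty l], ?_, ?_⟩
    · simp; omega
    · simp; omega

end ValidInput

end Listing

theorem mainTheorem2 :
    ∃ C : ℕ, ∀ (V : Type) [Fintype V] [DecidableEq V] (G : SimpleGraph V) (w : Sym2 V → ℚ)
      (A : AdjGraph V) (R : SSSPRoutine V) (tt : ℕ → ℕ → ℕ) (K : ℕ) (s t : V) (α : ℚ),
      2 ≤ Fintype.card V → G.Connected → (∀ e ∈ G.edgeSet, 0 ≤ w e) →
      (∀ v, v ∈ A.verts) → A.Represents G w →
      (∀ n n' m m', n ≤ n' → m ≤ m' → tt n m ≤ tt n' m') → R.Solves tt K →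
      -- every path is output exactly once
      ((listAllPaths R A s t α).out.Nodup ∧
        ∀ l : List V, l ∈ (listAllPaths R A s t α).out ↔ l ∈ boundedPaths G w [] s t α) ∧
      -- total time
      (listAllPaths R A s t α).time ≤
        C * ((G.edgeSet.ncard + tt (Fintype.card V) G.edgeSet.ncard) *
          max 1 (boundedPaths G w [] s t α).ncard) ∧
      -- memory, with the input
      A.size + (listAllPaths R A s t α).peak ≤ C * (K + 1) * G.edgeSet.ncard ∧
      -- the calls in the recursion tree
      ((boundedPaths G w [] s t α).Nonempty →
        ∀ c : Call V, Relation.ReflTransGen (IsChildCall R A t) ⟨s, α, []⟩ c →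
          (boundedPaths G w c.pre c.u t c.α).Nonempty ∧
          IsLongestCommonPrefix (callBody R A t c).val.1 (boundedPaths G w c.pre c.u t c.α) ∧
          ((callBody R A t c).val.2 = [] ∧ (callBody R A t c).val.1.getLast? = some t ∨
            2 ≤ (callBody R A t c).val.2.length)) := by
  -- by connectedness and `2 ≤ n`, the numbers of vertices and of adjacency list entries are at
  -- most `2 * m`, so `1000` covers the explicit constants of `listAllPaths_spec`
  refine ⟨1000, ?_⟩
  intro V _ _ G w A R tt K s t α hcard hconn hw hverts hA htt hR
  have hI : ValidInput G w A R tt K := ⟨hw, hverts, hA, htt, hR⟩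
  obtain ⟨h1, h2, h3, h4⟩ := hI.listAllPaths_spec le_rfl le_rfl s t α
  have hM := hI.sum_nbrs_le
  have hN := hconn.card_vert_le_card_edgeSet_add_one
  rw [Nat.card_eq_fintype_card, Nat.card_coe_set_eq] at hN
  refine ⟨⟨h1, h2⟩, ?_, ?_, ?_⟩
  · have hset : boundedPaths G w [] s t α = ((listAllPaths R A s t α).out.toFinset : Set _) := by
      ext l; simp [h2]
    rw [hset, Set.ncard_coe_finset, List.toFinset_card_of_nodup h1]
    refine h3.trans ?_
    rw [← mul_assoc]
    calc _ ≤ (300 * (G.edgeSet.ncard + tt (Fintype.card V) G.edgeSet.ncard)) *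
          (3 * max 1 (listAllPaths R A s t α).out.length) :=
          Nat.mul_le_mul (by omega) (by omega)
      _ ≤ _ := by
          rw [show ∀ a b : ℕ, 300 * a * (3 * b) = 900 * (a * b) by intros; ring, mul_assoc]
          exact Nat.mul_le_mul_right _ (by omega)
  · rw [hI.size_eq]
    have hK : K * (Fintype.card V + G.edgeSet.ncard) ≤ 3 * (K * G.edgeSet.ncard) := by
      rw [show 3 * (K * G.edgeSet.ncard) = K * (3 * G.edgeSet.ncard) by ring]
      exact Nat.mul_le_mul_left K (by omega)
    rw [show 1000 * (K + 1) * G.edgeSet.ncard =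
      1000 * (K * G.edgeSet.ncard) + 1000 * G.edgeSet.ncard by ring]
    omega
  · intro hne c hc
    have hgood := hI.goodCall_of_reachable ⟨List.nodup_nil, hne⟩ hc
    obtain ⟨π, u', cs, hval, -, hlast, -, hlcp, hcase, -⟩ := hI.callBody_spec (R := R) hgood
    rw [hval]
    refine ⟨hgood.nonempty, hlcp, ?_⟩
    rcases hcase with ⟨rfl, rfl, -⟩ | ⟨htwo, -⟩
    · exact .inl ⟨rfl, hlast⟩
    · exact .inr htwo
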